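/- **Definitions.** A *$*$-continuous Kleene algebra* is an idempotent semiring $(S,\vee,\cdot,\bot,1)$, ordered by $x\le y\iff x\vee y=y$, with an operation $*$ such that $xy^*z=\bigvee_{n\ge 0}xy^nz$ for all $x,y,z\in S$. A sequence $x_0,x_1,\ldots$ in $S$ is *finitary* if there is a finite set $F\subseteq S$ such that every $x_n$ is a finite product of elements of $F$. A *finitary $*$-continuous Kleene $\omega$-algebra* $(S,V)$ consists of a $*$-continuous Kleene algebra $S$, a (necessarily idempotent) unitary left $S$-semimodule $(V,\vee,\bot)$ with its natural order, and an infinite product assigning to each finitary sequence $(x_n)_{n\ge0}$ in $S$ an element $\prod_{n\ge 0}x_n\in V$, such that (all the suprema being asserted to exist): * $xy^*v=\bigvee_{n\ge 0}xy^nv$ for $x,y\in S$, $v\in V$; * $\prod_{n\ge 0}x_n=x_0\prod_{n\ge 0}x_{n+1}$ for every finitary $(x_n)$; * $\prod_{n\ge 0}x_n=\prod_{k\ge 0}(x_{n_k}\cdots x_{n_{k+1}-1})$ for every finitary $(x_n)$ and all integers $0=n_0\le n_1\le\cdots$ increasing without bound; * $\prod_{n\ge 0}x_n(y\vee z)=\bigvee_{x'_n\in\{y,z\}}\prod_{n\ge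 0}x_nx'_n$ for every finitary $(x_n)$ and $y,z\in S$; * $\prod_{n\ge 0}x^*y_n=\bigvee_{k_0,k_1,\ldots\ge 0}\prod_{n\ge 0}x^{k_n}y_n$ for $x\in S$ and every finitary $(y_n)$. Put $x^\omega=\prod_{n\ge 0}x$. A *homomorphism* $(S,V)\to(S',V')$ is a pair of functions $S\to S'$, $V\to V'$ that together preserve all the operations (on $S$: $\vee,\cdot,\bot,1,{}^*$; on $V$: $\vee,\bot$; the action; the infinite product of finitary sequences). For a set $A$ (finite or infinite), let $R(A^*)$ be the set of all languages over $A$ denoted by regular expressions, with union, concatenation, $\emptyset$, $\{\epsilon\}$ and Kleene star. Let $A^\omega$ be the set of $\omega$-words over $A$ and $A^\infty=A^*\cup A^\omega$. Let $R'(A^\infty)$ be the collection of all finite unions of sets $\{u_0u_1\cdots\in A^\infty:u_n\in R_n,\ n\ge 0\}$ with all $R_n\in R(A^*)$ and $\{R_0,R_1,\ldots\}$ finite, and let $R'(A^\omega)=\{Y\cap A^\omega:Y\in R'(A^\infty)\}$, with union and $\emptyset$, the action $XY=\{xy:x\in X,\ y\in Y\}$ of $R(A^*)$, and the infinite product $\prod_{n\ge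 0}X_n=\{u_0u_1\cdots\in A^\omega:u_n\in X_n,\ n\ge 0\}$ of finitary sequences over $R(A^*)$. **Corollary.** For every set $A$, $(R(A^*),R'(A^\omega))$ is the free finitary $*$-continuous Kleene $\omega$-algebra satisfying $1^\omega=\bot$, freely generated by $A$. That is, $(R(A^*),R'(A^\omega))$ is a finitary $*$-continuous Kleene $\omega$-algebra satisfying $1^\omega=\bot$, and for every finitary $*$-continuous Kleene $\omega$-algebra $(S,V)$ satisfying $1^\omega=\bot$ and every function $h:A\to S$ there is a unique homomorphism $(h_S,h_V):(R(A^*),R'(A^\omega))\to(S,V)$ such that $h_S(\{a\})=h(a)$ for all $a\in A$. -/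

import Mathlib

open Set Filter
open scoped Computability

universe u v w

/-! ## Finitary sequences -/

/-- A sequence over a monoid is finitary if, for some finite set `F`, each of its terms is a
finite product of elements of `F`. -/
def IsFinitary {S : Type*} [Monoid S] (x : ℕ → S) : Prop :=
  ∃ F : Set S, F.Finite ∧ ∀ n, ∃ l : List S, (∀ a ∈ l, a ∈ F) ∧ x n = l.prod

namespace IsFinitary

variable {S : Type*} [Monoid S]

theorem of_mem_finite {x : ℕ → S} {F : Set S} (hF : F.Finite) (h : ∀ n, x n ∈ F) :
    IsFinitary x :=
  ⟨F, hF, fun n => ⟨[x n], by simpa using h n, by simp⟩⟩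

theorem const (a : S) : IsFinitary (fun _ : ℕ => a) :=
  of_mem_finite (Set.finite_singleton a) (fun _ => rfl)

theorem mul {x y : ℕ → S} (hx : IsFinitary x) (hy : IsFinitary y) :
    IsFinitary (fun n => x n * y n) := by
  obtain ⟨F, hF, hx⟩ := hx
  obtain ⟨G, hG, hy⟩ := hy
  refine ⟨F ∪ G, hF.union hG, fun n => ?_⟩
  obtain ⟨l, hl, hxl⟩ := hx n
  obtain ⟨m, hm, hym⟩ := hy n
  refine ⟨l ++ m, fun a ha => ?_, by simp [hxl, hym]⟩
  rcases List.mem_append.1 ha with h | h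
  · exact Or.inl (hl a h)
  · exact Or.inr (hm a h)

theorem pow (a : S) (k : ℕ → ℕ) : IsFinitary (fun n => a ^ k n) :=
  ⟨{a}, Set.finite_singleton a, fun n =>
    ⟨List.replicate (k n) a, fun b hb => (List.mem_replicate.1 hb).2, by simp⟩⟩

theorem list_prod_comp {x : ℕ → S} (hx : IsFinitary x) (L : ℕ → List ℕ) :
    IsFinitary (fun k => ((L k).map x).prod) := by
  obtain ⟨F, hF, hx⟩ := hx
  refine ⟨F, hF, fun k => ?_⟩
  show ∃ l : List S, (∀ a ∈ l, a ∈ F) ∧ ((L k).map x).prod = l.prod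
  induction L k with
  | nil => exact ⟨[], by simp, by simp⟩
  | cons i t ih =>
    obtain ⟨m, hm, e⟩ := ih
    obtain ⟨l, hl, hxl⟩ := hx i
    refine ⟨l ++ m, fun a ha => ?_, by simp [hxl, e]⟩
    rcases List.mem_append.1 ha with h | h
    · exact hl a h
    · exact hm a h

theorem shift {x : ℕ → S} (hx : IsFinitary x) : IsFinitary (fun n => x (n + 1)) :=
  let ⟨F, hF, h⟩ := hx
  ⟨F, hF, fun n => h (n + 1)⟩

theorem map {S' : Type*} [Monoid S'] {x : ℕ → S} (hx : IsFinitary x) (f : S →* S') :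
    IsFinitary (fun n => f (x n)) := by
  obtain ⟨F, hF, hx⟩ := hx
  refine ⟨f '' F, hF.image f, fun n => ?_⟩
  obtain ⟨l, hl, hxl⟩ := hx n
  refine ⟨l.map f, fun a ha => ?_, by simp only [hxl, map_list_prod]⟩
  obtain ⟨b, hb, rfl⟩ := List.mem_map.1 ha
  exact ⟨b, hl b hb, rfl⟩

end IsFinitary

/-- The type of finitary sequences over `S`, the domain of the infinite product. -/
def FinitarySeq (S : Type*) [Monoid S] : Type _ := {x : ℕ → S // IsFinitary x}

namespace FinitarySeq

variable {S : Type*} [Monoid S]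

/-- The constant sequence `a, a, …`. -/
def const (a : S) : FinitarySeq S := ⟨fun _ => a, .const a⟩

/-- The sequence `x₁, x₂, …`. -/
def shift (x : FinitarySeq S) : FinitarySeq S := ⟨fun n => x.1 (n + 1), x.2.shift⟩

/-- The sequence whose `k`-th term is `x_{b k} ⋯ x_{b (k+1) - 1}` (the empty product is `1`). -/
def blocks (x : FinitarySeq S) (b : ℕ → ℕ) : FinitarySeq S :=
  ⟨fun k => ((List.Ico (b k) (b (k + 1))).map x.1).prod, x.2.list_prod_comp _⟩

/-- The sequence of the products `xₙ * a`. -/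
def mulRight (x : FinitarySeq S) (a : S) : FinitarySeq S :=
  ⟨fun n => x.1 n * a, x.2.mul (.const a)⟩

/-- The sequence of the products `a * xₙ`. -/
def mulLeft (a : S) (x : FinitarySeq S) : FinitarySeq S :=
  ⟨fun n => a * x.1 n, (IsFinitary.const a).mul x.2⟩

/-- The sequence of the products `xₙ * cₙ`, where each `cₙ` is `y` or `z`. -/
def mulChoice (x : FinitarySeq S) (y z : S) (c : ℕ → S) (hc : ∀ n, c n ∈ ({y, z} : Set S)) :
    FinitarySeq S :=
  ⟨fun n => x.1 n * c n, x.2.mul (.of_mem_finite (by simp) hc)⟩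

/-- The sequence of the products `a ^ kₙ * xₙ`. -/
def powMul (a : S) (k : ℕ → ℕ) (x : FinitarySeq S) : FinitarySeq S :=
  ⟨fun n => a ^ k n * x.1 n, (IsFinitary.pow a k).mul x.2⟩

/-- The image of a sequence under a monoid homomorphism. -/
def map {S' : Type*} [Monoid S'] (f : S →* S') (x : FinitarySeq S) : FinitarySeq S' :=
  ⟨fun n => f (x.1 n), x.2.map f⟩

end FinitarySeq

/-! ## Finitary `*`-continuous Kleene `ω`-algebras -/

/-- A `*`-continuous Kleene algebra: an idempotent semiring in which
`x y∗ z` is the least upper bound of all the `x yⁿ z` (so that `y∗` is that of all the `yⁿ`). -/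
class IsStarContinuous (S : Type*) [IdemSemiring S] [KStar S] : Prop where
  isLUB_mul_pow_mul : ∀ x y z : S, IsLUB (range fun n : ℕ => x * y ^ n * z) (x * y∗ * z)

/-- The operations that connect the two sorts: the left action of `S` on `V`, and the
infinite product of finitary sequences. -/
class FinitaryOmegaOps (S : Type*) (V : Type*) [Monoid S] extends SMul S V where
  infProd : FinitarySeq S → V

/-- The infinite product `∏ₙ xₙ` of a finitary sequence. -/
def infProd {S : Type*} (V : Type*) [Monoid S] [FinitaryOmegaOps S V] (x : FinitarySeq S) : V :=
  FinitaryOmegaOps.infProd x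

/-- The `ω`-power `x^ω = x x x ⋯`. -/
def omegaPow {S : Type*} (V : Type*) [Monoid S] [FinitaryOmegaOps S V] (x : S) : V :=
  infProd V (FinitarySeq.const x)

/-- The laws of a finitary `*`-continuous Kleene `ω`-algebra `(S, V)`. The idempotent commutative
monoid `(V, ∨, ⊥)` with its natural order is a join-semilattice with a least element. -/
structure IsFinitaryKleeneOmegaAlgebra (S : Type*) (V : Type*) [IdemSemiring S] [KStar S]
    [SemilatticeSup V] [OrderBot V] [FinitaryOmegaOps S V] : Prop
    extends IsStarContinuous S where
  add_smul : ∀ (s t : S) (v : V), (s + t) • v = s • v ⊔ t • v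
  smul_sup : ∀ (s : S) (v w : V), s • (v ⊔ w) = s • v ⊔ s • w
  mul_smul : ∀ (s t : S) (v : V), (s * t) • v = s • t • v
  zero_smul : ∀ v : V, (0 : S) • v = ⊥
  smul_bot : ∀ s : S, s • (⊥ : V) = ⊥
  one_smul : ∀ v : V, (1 : S) • v = v
  isLUB_mul_pow_smul : ∀ (x y : S) (v : V),
    IsLUB (range fun n : ℕ => (x * y ^ n) • v) ((x * y∗) • v)
  infProd_eq_smul : ∀ x : FinitarySeq S, infProd V x = x.1 0 • infProd V x.shift
  infProd_blocks : ∀ (x : FinitarySeq S) (b : ℕ → ℕ), b 0 = 0 → Monotone b →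
    Tendsto b atTop atTop → infProd V x = infProd V (x.blocks b)
  isLUB_infProd_add : ∀ (x : FinitarySeq S) (y z : S),
    IsLUB {v : V | ∃ (c : ℕ → S) (hc : ∀ n, c n ∈ ({y, z} : Set S)),
        v = infProd V (x.mulChoice y z c hc)}
      (infProd V (x.mulRight (y + z)))
  isLUB_infProd_star : ∀ (x : S) (y : FinitarySeq S),
    IsLUB (range fun k : ℕ → ℕ => infProd V (y.powMul x k)) (infProd V (y.mulLeft (x∗)))

/-- Homomorphisms `(S, V) → (S', V')`: pairs of functions that preserve all the operations. -/
structure KleeneOmegaHom (S : Type*) (V : Type*) (S' : Type*) (V' : Type*)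
    [IdemSemiring S] [KStar S] [SemilatticeSup V] [OrderBot V] [FinitaryOmegaOps S V]
    [IdemSemiring S'] [KStar S'] [SemilatticeSup V'] [OrderBot V'] [FinitaryOmegaOps S' V'] where
  onS : S →+* S'
  onV : SupBotHom V V'
  map_kstar : ∀ x : S, onS x∗ = (onS x)∗
  map_smul : ∀ (x : S) (v : V), onV (x • v) = onS x • onV v
  map_infProd : ∀ x : FinitarySeq S,
    onV (infProd V x) = infProd V' (x.map (onS : S →* S'))

/-! ## Regular languages of finite words -/

/-- The regular languages over an arbitrary (possibly infinite) alphabet `A`, that is,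
the languages denoted by regular expressions. -/
def regSubsemiring (A : Type u) : Subsemiring (Language A) where
  carrier := {L | ∃ r : RegularExpression A, r.matches' = L}
  mul_mem' := by rintro _ _ ⟨r, rfl⟩ ⟨t, rfl⟩; exact ⟨r * t, rfl⟩
  one_mem' := ⟨1, rfl⟩
  add_mem' := by rintro _ _ ⟨r, rfl⟩ ⟨t, rfl⟩; exact ⟨r + t, rfl⟩
  zero_mem' := ⟨0, rfl⟩

/-- `R(A*)`, with union, concatenation, `∅` and `{ε}`. -/
def RegLang (A : Type u) : Type u := regSubsemiring A

namespace RegLang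

variable {A : Type u}

/-- The underlying language. -/
def lang (X : RegLang A) : Language A := X.1

instance : Semiring (RegLang A) := inferInstanceAs (Semiring (regSubsemiring A))

/-- The order is the natural one, `X ≤ Y` iff `X + Y = Y`, that is, inclusion. -/
instance : IdemSemiring (RegLang A) :=
  IdemSemiring.ofSemiring fun X => Subtype.ext (Language.add_self X.1)

instance : KStar (RegLang A) where
  kstar X := ⟨X.1∗, by obtain ⟨r, hr⟩ := X.2; exact ⟨r.star, by rw [← hr]; rfl⟩⟩

/-- The language `{a}`. -/
def letter (a : A) : RegLang A := ⟨{[a]}, RegularExpression.char a, rfl⟩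

end RegLang

/-! ## Finite and infinite words -/

/-- `u₀ u₁ ⋯ uₙ₋₁`. -/
def prefixWord {A : Type*} (u : ℕ → List A) (n : ℕ) : List A := ((List.range n).map u).flatten

/-- The concatenation `u₀ u₁ u₂ ⋯` is the `ω`-word `s`. -/
def OmegaConcat {A : Type*} (u : ℕ → List A) (s : Stream' A) : Prop :=
  (∀ n, prefixWord u n = s.take (prefixWord u n).length) ∧ ∀ m, ∃ n, m ≤ (prefixWord u n).length

/-- `A^∞ = A* ∪ A^ω`. -/
abbrev InftyWord (A : Type*) := List A ⊕ Stream' A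

/-- The concatenation `u₀ u₁ u₂ ⋯` is the finite or infinite word `w`. -/
def InftyConcat {A : Type*} (u : ℕ → List A) : InftyWord A → Prop
  | Sum.inl w => ∃ N, (∀ n, N ≤ n → u n = []) ∧ w = prefixWord u N
  | Sum.inr s => OmegaConcat u s

/-- `∏ₙ Xₙ = {u₀ u₁ ⋯ : uₙ ∈ Xₙ} ⊆ A^∞`. -/
def inftyProd {A : Type u} (X : ℕ → RegLang A) : Set (InftyWord A) :=
  {w | ∃ u : ℕ → List A, (∀ n, u n ∈ (X n).lang) ∧ InftyConcat u w}

/-- `R'(A^∞)`: the finite unions of sets `∏ₙ Rₙ` with regular `Rₙ ⊆ A*` and `{R₀, R₁, …}`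
finite. -/
def regInfty (A : Type u) : Set (Set (InftyWord A)) :=
  {Y | ∃ (k : ℕ) (R : Fin k → ℕ → RegLang A),
    (∀ i, (range (R i)).Finite) ∧ Y = ⋃ i, inftyProd (R i)}

/-- `Y ∩ A^ω`, as a set of `ω`-words. -/
def omegaPart {A : Type*} (Y : Set (InftyWord A)) : Set (Stream' A) := {s | Sum.inr s ∈ Y}

/-- `R'(A^ω)`: the sets `Y ∩ A^ω` with `Y` in `R'(A^∞)`. -/
def RegOmega (A : Type u) : Type u :=
  {Z : Set (Stream' A) // ∃ Y ∈ regInfty A, omegaPart Y = Z}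

/-! ### Closure of `R'(A^ω)` under the operations -/

theorem prefixWord_zero {A : Type*} (u : ℕ → List A) : prefixWord u 0 = [] := rfl

theorem prefixWord_succ {A : Type*} (u : ℕ → List A) (n : ℕ) :
    prefixWord u (n + 1) = prefixWord u n ++ u n := by
  simp [prefixWord, List.range_succ]

theorem prefixWord_succ' {A : Type*} (u : ℕ → List A) (n : ℕ) :
    prefixWord u (n + 1) = u 0 ++ prefixWord (fun k => u (k + 1)) n := by
  simp [prefixWord, List.range_succ_eq_map, Function.comp_def]

theorem prefixWord_prefix {A : Type*} (u : ℕ → List A) {m n : ℕ} (h : m ≤ n) :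
    prefixWord u m <+: prefixWord u n := by
  induction n, h using Nat.le_induction with
  | base => exact List.prefix_rfl
  | succ n _ ih => rw [prefixWord_succ]; exact ih.trans (List.prefix_append _ _)

theorem prefixWord_flatten {A : Type*} (l : ℕ → List (List A)) (n : ℕ) :
    prefixWord (fun k => (l k).flatten) n = (prefixWord l n).flatten := by
  induction n with
  | zero => rfl
  | succ n ih => simp [prefixWord_succ, ih]

theorem prefixWord_eq_flatten_take {A : Type*} (u : Stream' (List A)) (n : ℕ) :
    prefixWord u.get n = (u.take n).flatten := by
  induction n with
  | zero => rfl
  | succ n ih => rw [prefixWord_succ, Stream'.take_succ', List.flatten_append, ih]; simp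

theorem eq_take_of_prefix {A : Type*} {s : Stream' A} {l : List A} {n : ℕ}
    (h : l <+: s.take n) : l = s.take l.length := by
  have h1 := List.prefix_iff_eq_take.1 h
  have h2 : l.length ≤ n := by simpa using h.length_le
  rwa [Stream'.take_take, min_eq_right h2] at h1

theorem exists_omegaConcat {A : Type*} (u : ℕ → List A) (hu : ∀ n, u n ≠ []) :
    ∃ s, OmegaConcat u s := by
  have hlen : ∀ n, n ≤ (prefixWord u n).length := by
    intro n
    induction n with
    | zero => simp
    | succ n ih =>
      have := List.length_pos_iff.2 (hu n)
      rw [prefixWord_succ, List.length_append]; omega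
  let s : Stream' A := fun m => (prefixWord u (m + 1))[m]'(hlen (m + 1))
  refine ⟨s, fun n => ?_, fun m => ⟨m, hlen m⟩⟩
  refine List.ext_getElem (by simp) fun i h1 h2 => ?_
  have e : (s.take (prefixWord u n).length)[i] = s i := by
    have := Stream'.getElem?_take (s := s) h1
    rw [List.getElem?_eq_getElem h2] at this
    exact Option.some.inj this
  rw [e]
  show _ = (prefixWord u (i + 1))[i]'(hlen (i + 1))
  rcases le_total n (i + 1) with h | h
  · exact (prefixWord_prefix u h).getElem h1
  · exact ((prefixWord_prefix u h).getElem (hlen (i + 1))).symm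

theorem omegaConcat_flatten_iff {A : Type*} {l : ℕ → List (List A)} {U : Stream' (List A)}
    (h : OmegaConcat l U) (s : Stream' A) :
    OmegaConcat (fun n => (l n).flatten) s ↔ OmegaConcat U s := by
  have key : ∀ n, prefixWord (fun n => (l n).flatten) n
      = prefixWord U (prefixWord l n).length := by
    intro n
    rw [prefixWord_flatten]
    refine Eq.trans ?_ (prefixWord_eq_flatten_take U _).symm
    rw [← h.1 n]
  constructor
  · rintro ⟨h1, h2⟩
    refine ⟨fun j => ?_, fun m => ?_⟩
    · obtain ⟨n, hn⟩ := h.2 j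
      have hp := prefixWord_prefix U hn
      rw [← key n, h1 n] at hp
      exact eq_take_of_prefix hp
    · obtain ⟨n, hn⟩ := h2 m
      exact ⟨_, by rwa [key n] at hn⟩
  · rintro ⟨h1, h2⟩
    refine ⟨fun n => ?_, fun m => ?_⟩
    · rw [key n]; exact h1 _
    · obtain ⟨j, hj⟩ := h2 m
      obtain ⟨n, hn⟩ := h.2 j
      exact ⟨n, by rw [key n]; exact hj.trans (prefixWord_prefix U hn).length_le⟩

theorem RegLang.mem_lang_list_prod {A : Type u} (L : List (RegLang A)) (v : List A) :
    v ∈ L.prod.lang ↔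
      ∃ l : List (List A), List.Forall₂ (fun w (X : RegLang A) => w ∈ X.lang) l L ∧
        l.flatten = v := by
  induction L generalizing v with
  | nil =>
    simp only [List.prod_nil, List.forall₂_nil_right_iff, exists_eq_left, List.flatten_nil]
    exact (Language.mem_one v).trans eq_comm
  | cons X L ih =>
    rw [List.prod_cons]
    constructor
    · intro h
      obtain ⟨a, ha, b, hb, rfl⟩ := Language.mem_mul.1 (show v ∈ X.lang * L.prod.lang from h)
      obtain ⟨l, hl, rfl⟩ := (ih b).1 hb
      exact ⟨a :: l, .cons ha hl, by simp⟩
    · rintro ⟨l, hl, rfl⟩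
      cases hl with
      | cons ha hl =>
        exact Language.append_mem_mul ha ((ih _).2 ⟨_, hl, rfl⟩)

theorem forall₂_prefixWord {A B : Type*} {P : A → B → Prop} {u : ℕ → List A} {v : ℕ → List B}
    (h : ∀ n, List.Forall₂ P (u n) (v n)) (n : ℕ) :
    List.Forall₂ P (prefixWord u n) (prefixWord v n) := by
  induction n with
  | zero => exact .nil
  | succ n ih => rw [prefixWord_succ, prefixWord_succ]; exact List.rel_append ih (h n)

theorem getElem_take_stream {A : Type*} (s : Stream' A) (n i : ℕ) (h : i < (s.take n).length) :
    (s.take n)[i] = s.get i := by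
  have := Stream'.getElem?_take (s := s) (k := i) (n := n) (by simpa using h)
  rw [List.getElem?_eq_getElem h] at this
  exact Option.some.inj this

theorem forall₂_take_iff {A B : Type*} {P : A → B → Prop} {u : Stream' A} {v : Stream' B}
    (n : ℕ) : List.Forall₂ P (u.take n) (v.take n) ↔ ∀ i < n, P (u.get i) (v.get i) := by
  rw [List.forall₂_iff_get]
  constructor
  · rintro ⟨_, h⟩ i hi
    have := h i (by simpa using hi) (by simpa using hi)
    simpa [getElem_take_stream] using this
  · intro h
    refine ⟨by simp, fun i h1 h2 => ?_⟩
    simpa [getElem_take_stream] using h i (by simpa using h1)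

/-- The infinite product of a finitary sequence is one of a sequence with finitely many terms. -/
theorem exists_finite_range_omegaPart {A : Type u} (X : FinitarySeq (RegLang A)) :
    ∃ R : ℕ → RegLang A, (range R).Finite ∧
      omegaPart (inftyProd R) = omegaPart (inftyProd X.1) := by
  obtain ⟨x, F, hF, hx⟩ := X
  have hx' := hx
  choose l0 hl0 hx' using hx'
  let L : ℕ → List (RegLang A) := fun n => 1 :: l0 n
  have hxL : ∀ n, x n = (L n).prod := fun n => by simp [L, hx' n]
  obtain ⟨R, hR⟩ := exists_omegaConcat L (fun n => List.cons_ne_nil _ _)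
  have hmem : ∀ n, ∀ Y ∈ prefixWord L n, Y ∈ insert 1 F := by
    intro n Y hY
    simp only [prefixWord, List.mem_flatten, List.mem_map] at hY
    obtain ⟨_, ⟨k, _, rfl⟩, hY⟩ := hY
    rcases List.mem_cons.1 hY with h | h
    · exact Or.inl h
    · exact Or.inr (hl0 k _ h)
  refine ⟨R, (hF.insert 1).subset ?_, ?_⟩
  · rintro _ ⟨m, rfl⟩
    obtain ⟨n, hn⟩ := hR.2 (m + 1)
    refine hmem n _ ?_
    rw [hR.1 n]
    exact List.mem_of_getElem? (Stream'.getElem?_take (s := R) (by omega))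
  · ext s
    constructor
    · rintro ⟨U', hU, hUs⟩
      obtain ⟨U, rfl⟩ : ∃ U : Stream' (List A), U' = U.get := ⟨U', rfl⟩
      let c : ℕ → ℕ := fun n => (prefixWord L n).length
      have hc : ∀ n, c n ≤ c (n + 1) := fun n =>
        (prefixWord_prefix L (Nat.le_succ n)).length_le
      let l : ℕ → List (List A) := fun n => (Stream'.take (c (n + 1)) U).drop (c n)
      have hpl : ∀ n, prefixWord l n = Stream'.take (c n) U := by
        intro n
        induction n with
        | zero => rfl
        | succ n ih =>
          rw [prefixWord_succ, ih]
          have : Stream'.take (c n) U = (Stream'.take (c (n + 1)) U).take (c n) := by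
            rw [Stream'.take_take, min_eq_right (hc n)]
          rw [this]
          exact List.take_append_drop _ _
      have hL : ∀ n, L n = (Stream'.take (c (n + 1)) R).drop (c n) := by
        intro n
        rw [← hR.1 (n + 1), prefixWord_succ, List.drop_left']
        rfl
      have hlU : OmegaConcat l U := by
        refine ⟨fun n => ?_, fun m => ?_⟩
        · rw [hpl n, Stream'.length_take]
        · obtain ⟨n, hn⟩ := hR.2 m
          exact ⟨n, by rw [hpl n, Stream'.length_take]; exact hn⟩
      refine ⟨fun n => (l n).flatten, fun n => ?_, (omegaConcat_flatten_iff hlU s).2 hUs⟩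
      show _ ∈ (x n).lang
      rw [hxL n]
      refine (RegLang.mem_lang_list_prod _ _).2 ⟨l n, ?_, rfl⟩
      rw [hL n]
      exact List.forall₂_drop _ ((forall₂_take_iff (u := U) (v := R) _).2 fun i _ => hU i)
    · rintro ⟨v, hv, hvs⟩
      have hv' : ∀ n, ∃ l : List (List A),
          List.Forall₂ (fun w (X : RegLang A) => w ∈ X.lang) l (L n) ∧ l.flatten = v n := by
        intro n
        refine (RegLang.mem_lang_list_prod _ _).1 ?_
        rw [← hxL n]; exact hv n
      choose l hl hlv using hv'
      obtain ⟨U, hU⟩ := exists_omegaConcat l (fun n hn => by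
        have := hl n
        rw [hn] at this
        cases this)
      have hv2 : v = fun n => (l n).flatten := funext fun n => (hlv n).symm
      refine ⟨U, fun m => ?_, (omegaConcat_flatten_iff hU s).1 (by rw [← hv2]; exact hvs)⟩
      obtain ⟨n, hn⟩ := hR.2 (m + 1)
      have hf := forall₂_prefixWord hl n
      have e := hf.length_eq
      rw [hU.1 n, hR.1 n, e] at hf
      exact (forall₂_take_iff (u := U) (v := R) _).1 hf m (by omega)

theorem omegaConcat_cons_iff {A : Type*} (u : ℕ → List A) (s : Stream' A) :
    OmegaConcat u s ↔
      ∃ t, s = Stream'.appendStream' (u 0) t ∧ OmegaConcat (fun n => u (n + 1)) t := by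
  have htake : ∀ (x : List A) (t : Stream' A) (k : ℕ),
      (Stream'.appendStream' x t).take (x.length + k) = x ++ t.take k := by
    intro x t k
    induction x with
    | nil => simp
    | cons a x ih =>
      rw [Stream'.cons_append_stream, List.length_cons,
        show x.length + 1 + k = (x.length + k) + 1 by omega, Stream'.take_succ_cons, ih]
      rfl
  constructor
  · rintro ⟨h1, h2⟩
    have h0 : u 0 = s.take (u 0).length := by simpa [prefixWord] using h1 1
    have hs : s = Stream'.appendStream' (u 0) (s.drop (u 0).length) := by
      conv_lhs => rw [← Stream'.append_take_drop (u 0).length s, ← h0]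
    refine ⟨s.drop (u 0).length, hs, fun n => ?_, fun m => ?_⟩
    · have := h1 (n + 1)
      rw [prefixWord_succ', List.length_append] at this
      rw [hs, htake] at this
      exact List.append_cancel_left this
    · obtain ⟨n, hn⟩ := h2 ((u 0).length + m)
      refine ⟨n, ?_⟩
      have := (prefixWord_prefix u (Nat.le_succ n)).length_le
      rw [Nat.succ_eq_add_one, prefixWord_succ', List.length_append] at this
      omega
  · rintro ⟨t, rfl, h1, h2⟩
    refine ⟨fun n => ?_, fun m => ?_⟩
    · cases n with
      | zero => rfl
      | succ n => rw [prefixWord_succ', List.length_append, htake, ← h1 n]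
    · obtain ⟨n, hn⟩ := h2 m
      exact ⟨n + 1, by rw [prefixWord_succ', List.length_append]; omega⟩

theorem omegaPart_iUnion {A : Type*} {ι : Sort*} (Y : ι → Set (InftyWord A)) :
    omegaPart (⋃ i, Y i) = ⋃ i, omegaPart (Y i) := by
  ext s; simp [omegaPart]

/-- `X Z = {x z : x ∈ X, z ∈ Z}` for `X ⊆ A*` and `Z ⊆ A^ω`. -/
def omegaAct {A : Type u} (X : Language A) (Z : Set (Stream' A)) : Set (Stream' A) :=
  {s | ∃ x ∈ X, ∃ z ∈ Z, s = Stream'.appendStream' x z}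

theorem omegaAct_omegaPart {A : Type u} (X : RegLang A) (R : ℕ → RegLang A) :
    omegaAct X.lang (omegaPart (inftyProd R)) =
      omegaPart (inftyProd fun n => Nat.casesOn n X R) := by
  ext s
  constructor
  · rintro ⟨x, hx, z, ⟨u, hu, huz⟩, rfl⟩
    refine ⟨fun n => Nat.casesOn n x u, fun n => ?_, ?_⟩
    · cases n with
      | zero => exact hx
      | succ n => exact hu n
    · exact (omegaConcat_cons_iff _ _).2 ⟨z, rfl, huz⟩
  · rintro ⟨u, hu, hus⟩
    obtain ⟨t, rfl, ht⟩ := (omegaConcat_cons_iff u s).1 hus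
    exact ⟨u 0, hu 0, t, ⟨fun n => u (n + 1), fun n => hu (n + 1), ht⟩, rfl⟩

namespace RegOmega

variable {A : Type u}

theorem empty_mem : ∃ Y ∈ regInfty A, omegaPart Y = ∅ :=
  ⟨∅, ⟨0, Fin.elim0, fun i => i.elim0, by simp⟩, rfl⟩

theorem union_mem {Z W : Set (Stream' A)} (hZ : ∃ Y ∈ regInfty A, omegaPart Y = Z)
    (hW : ∃ Y ∈ regInfty A, omegaPart Y = W) : ∃ Y ∈ regInfty A, omegaPart Y = Z ∪ W := by
  obtain ⟨_, ⟨k, R, hR, rfl⟩, rfl⟩ := hZ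
  obtain ⟨_, ⟨m, T, hT, rfl⟩, rfl⟩ := hW
  refine ⟨_, ⟨k + m, Fin.append R T, fun i => ?_, rfl⟩, ?_⟩
  · induction i using Fin.addCases with
    | left i => simpa using hR i
    | right i => simpa using hT i
  · ext s
    simp only [omegaPart_iUnion, Set.mem_iUnion, Set.mem_union]
    constructor
    · rintro ⟨i, hi⟩
      induction i using Fin.addCases with
      | left i => exact Or.inl ⟨i, by simpa using hi⟩
      | right i => exact Or.inr ⟨i, by simpa using hi⟩
    · rintro (⟨i, hi⟩ | ⟨i, hi⟩)
      · exact ⟨Fin.castAdd m i, by simpa using hi⟩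
      · exact ⟨Fin.natAdd k i, by simpa using hi⟩

theorem act_mem (X : RegLang A) {Z : Set (Stream' A)}
    (hZ : ∃ Y ∈ regInfty A, omegaPart Y = Z) :
    ∃ Y ∈ regInfty A, omegaPart Y = omegaAct X.lang Z := by
  obtain ⟨_, ⟨k, R, hR, rfl⟩, rfl⟩ := hZ
  refine ⟨_, ⟨k, fun i n => Nat.casesOn n X (R i), fun i => ?_, rfl⟩, ?_⟩
  · refine ((hR i).insert X).subset ?_
    rintro _ ⟨n, rfl⟩
    cases n with
    | zero => exact Or.inl rfl
    | succ n => exact Or.inr ⟨n, rfl⟩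
  · rw [omegaPart_iUnion, omegaPart_iUnion]
    ext s
    rw [Set.mem_iUnion]
    constructor
    · rintro ⟨i, hi⟩
      rw [← omegaAct_omegaPart] at hi
      obtain ⟨x, hx, z, hz, rfl⟩ := hi
      exact ⟨x, hx, z, Set.mem_iUnion.2 ⟨i, hz⟩, rfl⟩
    · rintro ⟨x, hx, z, hz, rfl⟩
      obtain ⟨i, hz⟩ := Set.mem_iUnion.1 hz
      refine ⟨i, ?_⟩
      rw [← omegaAct_omegaPart]
      exact ⟨x, hx, z, hz, rfl⟩

theorem infProd_mem (X : FinitarySeq (RegLang A)) :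
    ∃ Y ∈ regInfty A, omegaPart Y = omegaPart (inftyProd X.1) := by
  obtain ⟨R, hR, e⟩ := exists_finite_range_omegaPart X
  exact ⟨_, ⟨1, fun _ => R, fun _ => hR, rfl⟩, by rw [omegaPart_iUnion, Set.iUnion_const, e]⟩

/-- `R'(A^ω)` is ordered by inclusion; joins are unions. -/
instance : SemilatticeSup (RegOmega A) where
  le Z W := Z.1 ⊆ W.1
  le_refl _ := Set.Subset.rfl
  le_trans _ _ _ := Set.Subset.trans
  le_antisymm _ _ h h' := Subtype.ext (Set.Subset.antisymm h h')
  sup Z W := ⟨Z.1 ∪ W.1, union_mem Z.2 W.2⟩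
  le_sup_left _ _ := Set.subset_union_left
  le_sup_right _ _ := Set.subset_union_right
  sup_le _ _ _ := Set.union_subset

instance : OrderBot (RegOmega A) where
  bot := ⟨∅, empty_mem⟩
  bot_le _ := Set.empty_subset _

/-- The action `X Z = {x z : x ∈ X, z ∈ Z}` and the product
`∏ₙ Xₙ = {u₀ u₁ ⋯ ∈ A^ω : uₙ ∈ Xₙ}`. -/
instance : FinitaryOmegaOps (RegLang A) (RegOmega A) where
  smul X Z := ⟨omegaAct X.lang Z.1, act_mem X Z.2⟩
  infProd X := ⟨omegaPart (inftyProd X.1), infProd_mem X⟩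

end RegOmega

set_option linter.unusedSectionVars false

/-! ## Concatenations of sequences of lists -/

/-! On languages of finite words this is the classical argument: by `*`-continuity the value of a
regular expression, placed in any context, is the least upper bound of the values of its words.
Hence it depends only on the language (`regEval_congr`) and defines `RegLang.lift`.

An element of `R'(A^ω)` has many representations as a finite join of infinite products, so its value
is at first only a relation, `IsValue`. The crux is that this relation is monotone (`IsValue.mono`),
hence single-valued; since it is compatible with all the operations, it is then a homomorphism.
Uniqueness holds because letters generate everything under the operations.

It is tempting to prove monotonicity by writing a product as the supremum of the values of its
`ω`-words, but the action of `S` on `V` is not assumed to preserve such suprema, so this description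
cannot be carried past a first factor. Instead, `infProd_map_le_of_isValue` bounds the value of a
product by every value `b` of every `Z` containing it. The induction principle
`RegLang.finitarySeq_induction` reduces this to sequences of single words. When a factor is put in
front, each word `w` of it calls for a left quotient: some `Z' ⊇ w⁻¹ Z` with a value `b'` such that
`w b' ≤ b` (`IsValue.exists_word_deriv`). This exists because a finitary product can be rewritten
with finitely many distinct factors. For single words, the concatenation is either an `ω`-word of
`Z`, whose value lies below `b` by `IsValue.exists_isStreamValue_le`, or a finite word `u`, and then
the value is `u 1^ω = ⊥`. -/

theorem exists_omegaConcat_of_unbounded {A : Type*} (u : ℕ → List A)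
    (hu : ∀ m, ∃ n, m ≤ (prefixWord u n).length) : ∃ s, OmegaConcat u s := by
  choose f hf using fun m => hu (m + 1)
  let s : Stream' A := fun m => (prefixWord u (f m))[m]'(hf m)
  refine ⟨s, fun n => ?_, hu⟩
  refine List.ext_getElem (by simp) fun i h1 h2 => ?_
  rw [getElem_take_stream]
  show _ = (prefixWord u (f i))[i]'(hf i)
  rcases le_total n (f i) with h | h
  · exact (prefixWord_prefix u h).getElem h1
  · exact ((prefixWord_prefix u h).getElem (hf i)).symm

theorem prefixWord_map {A B : Type*} (f : A → B) (u : ℕ → List A) (n : ℕ) :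
    prefixWord (fun k => (u k).map f) n = (prefixWord u n).map f := by
  induction n with
  | zero => rfl
  | succ n ih => simp [prefixWord_succ, ih]

theorem stream_take_eq_map_Ico {A : Type*} (s : Stream' A) (n : ℕ) :
    s.take n = (List.Ico 0 n).map s.get := by
  rw [List.Ico.zero_bot]
  induction n with
  | zero => rfl
  | succ n ih => rw [Stream'.take_succ', ih, List.range_succ, List.map_append]; rfl

namespace OmegaConcat

variable {A B : Type*} {u : ℕ → List A} {s : Stream' A}

theorem map (f : A → B) (h : OmegaConcat u s) :
    OmegaConcat (fun n => (u n).map f) (s.map f) := by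
  refine ⟨fun n => ?_, fun m => ?_⟩
  · rw [prefixWord_map, List.length_map, ← Stream'.map_take, ← h.1 n]
  · obtain ⟨n, hn⟩ := h.2 m
    exact ⟨n, by rwa [prefixWord_map, List.length_map]⟩

theorem monotone_length (u : ℕ → List A) : Monotone fun n => (prefixWord u n).length :=
  fun _ _ h => (prefixWord_prefix u h).length_le

/-- Translates concatenations of lists into the block form of the regrouping law, with the prefix
lengths as cut points. -/
theorem eq_map_Ico (h : OmegaConcat u s) (n : ℕ) :
    u n = (List.Ico (prefixWord u n).length (prefixWord u (n + 1)).length).map s.get := by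
  have h1 := h.1 (n + 1)
  rw [stream_take_eq_map_Ico, ← List.Ico.append_consecutive (Nat.zero_le _)
    (monotone_length u n.le_succ), List.map_append, ← stream_take_eq_map_Ico, ← h.1 n] at h1
  nth_rewrite 1 [prefixWord_succ] at h1
  exact List.append_cancel_left h1

theorem prefixWord_Ico (s : Stream' A) {b : ℕ → ℕ} (h0 : b 0 = 0) (hb : Monotone b) (n : ℕ) :
    prefixWord (fun k => (List.Ico (b k) (b (k + 1))).map s.get) n = s.take (b n) := by
  induction n with
  | zero => simp [prefixWord, h0]
  | succ n ih =>
    rw [prefixWord_succ, ih, stream_take_eq_map_Ico, stream_take_eq_map_Ico, ← List.map_append,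
      List.Ico.append_consecutive (Nat.zero_le _) (hb n.le_succ)]

theorem of_Ico (s : Stream' A) {b : ℕ → ℕ} (h0 : b 0 = 0) (hb : Monotone b)
    (ht : Tendsto b atTop atTop) :
    OmegaConcat (fun k => (List.Ico (b k) (b (k + 1))).map s.get) s := by
  refine ⟨fun n => ?_, fun m => ?_⟩
  · rw [prefixWord_Ico s h0 hb, Stream'.length_take]
  · obtain ⟨n, hn⟩ := (ht.eventually_ge_atTop m).exists
    exact ⟨n, by rwa [prefixWord_Ico s h0 hb, Stream'.length_take]⟩

theorem tendsto_length (h : OmegaConcat u s) :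
    Tendsto (fun n => (prefixWord u n).length) atTop atTop :=
  tendsto_atTop_atTop_of_monotone (monotone_length u) h.2

theorem exists_mem (h : OmegaConcat u s) (m : ℕ) : ∃ n, s.get m ∈ u n := by
  obtain ⟨n, hn⟩ := h.2 (m + 1)
  have hm : s.get m ∈ prefixWord u n := by
    rw [h.1 n]
    exact List.mem_of_getElem? (Stream'.getElem?_take (s := s) (by omega))
  simp only [prefixWord, List.mem_flatten, List.mem_map] at hm
  obtain ⟨_, ⟨k, _, rfl⟩, hk⟩ := hm
  exact ⟨k, hk⟩

/-- Splitting one sequence of lists in parallel with another one. -/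
theorem exists_forall₂ {P : B → A → Prop} {l : ℕ → List B} (h : OmegaConcat u s)
    (hl : ∀ n, List.Forall₂ P (l n) (u n)) :
    ∃ t : Stream' B, OmegaConcat l t ∧ ∀ m, P (t.get m) (s.get m) := by
  have hlen : ∀ n, (prefixWord l n).length = (prefixWord u n).length :=
    fun n => (forall₂_prefixWord hl n).length_eq
  obtain ⟨t, ht⟩ := exists_omegaConcat_of_unbounded l fun m => by
    obtain ⟨n, hn⟩ := h.2 m
    exact ⟨n, by rwa [hlen]⟩
  refine ⟨t, ht, fun m => ?_⟩
  obtain ⟨n, hn⟩ := h.2 (m + 1)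
  have hf := forall₂_prefixWord hl n
  rw [ht.1 n, h.1 n, hlen] at hf
  exact (forall₂_take_iff (u := t) (v := s) _).1 hf m (by omega)

end OmegaConcat

/-! ## Finitary sequences -/

theorem isFinitary_iff_closure {S : Type*} [Monoid S] {x : ℕ → S} :
    IsFinitary x ↔ ∃ F : Set S, F.Finite ∧ ∀ n, x n ∈ Submonoid.closure F := by
  refine exists_congr fun F => and_congr_right fun _ => forall_congr' fun n => ⟨?_, ?_⟩
  · rintro ⟨l, hl, e⟩
    rw [e]
    exact list_prod_mem fun a ha => Submonoid.subset_closure (hl a ha)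
  · intro h
    obtain ⟨l, hl, e⟩ := Submonoid.exists_list_of_mem_closure h
    exact ⟨l, hl, e.symm⟩

namespace FinitarySeq

variable {S : Type*} [Monoid S]

/-- The sequence `xₘ, xₘ₊₁, …`. -/
def drop (x : FinitarySeq S) (m : ℕ) : FinitarySeq S :=
  ⟨fun n => x.1 (n + m), by
    obtain ⟨F, hF, h⟩ := x.2
    exact ⟨F, hF, fun n => h (n + m)⟩⟩

/-- The sequence of the products `xₙ * yₙ`. -/
def mul (x y : FinitarySeq S) : FinitarySeq S := ⟨fun n => x.1 n * y.1 n, x.2.mul y.2⟩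

end FinitarySeq

namespace FinitarySeq

variable {S : Type*} [Monoid S]

/-- The sequence `x₀, y₀, x₁, y₁, …`. -/
def interleave (x y : FinitarySeq S) : FinitarySeq S :=
  ⟨fun n => if n % 2 = 0 then x.1 (n / 2) else y.1 (n / 2), by
    obtain ⟨F, hF, hx⟩ := isFinitary_iff_closure.1 x.2
    obtain ⟨G, hG, hy⟩ := isFinitary_iff_closure.1 y.2
    refine isFinitary_iff_closure.2 ⟨F ∪ G, hF.union hG, fun n => ?_⟩
    split_ifs
    · exact Submonoid.closure_mono subset_union_left (hx _)
    · exact Submonoid.closure_mono subset_union_right (hy _)⟩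

theorem blocks_two_mul (x : FinitarySeq S) (k : ℕ) :
    (x.blocks fun k => 2 * k).1 k = x.1 (2 * k) * x.1 (2 * k + 1) := by
  show ((List.Ico (2 * k) (2 * (k + 1))).map x.1).prod = _
  rw [show 2 * (k + 1) = 2 * k + 1 + 1 by ring, List.Ico.succ_top (by omega),
    List.Ico.succ_top (by omega)]
  simp

theorem interleave_blocks (x y : FinitarySeq S) :
    (x.interleave y).blocks (fun k => 2 * k) = x.mul y := by
  refine Subtype.ext (funext fun k => ?_)
  rw [blocks_two_mul]
  simp only [interleave, mul]
  rw [if_pos (by omega), if_neg (by omega), show 2 * k / 2 = k by omega,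
    show (2 * k + 1) / 2 = k by omega]

/-- Together with `interleave_blocks` this regroups `(x₀ y₀)(x₁ y₁)⋯` as `x₀ (y₀ x₁)(y₁ x₂)⋯`,
turning right factors into left ones. -/
theorem interleave_shift (x y : FinitarySeq S) :
    (x.interleave y).shift = y.interleave x.shift := by
  refine Subtype.ext (funext fun n => ?_)
  simp only [interleave, shift]
  rcases Nat.mod_two_eq_zero_or_one n with h | h
  · rw [if_neg (by omega), if_pos h, show (n + 1) / 2 = n / 2 by omega]
  · rw [if_pos (by omega), if_neg (by omega), show (n + 1) / 2 = n / 2 + 1 by omega]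

/-- A finitary sequence over the submonoid generated by a finite set `T` arises by taking
products of blocks of a sequence over `T ∪ {1}`. -/
theorem exists_eq_blocks {T : Set S} (hT : T.Finite) {x : FinitarySeq S}
    (hx : ∀ n, x.1 n ∈ Submonoid.closure T) :
    ∃ (y : FinitarySeq S) (b : ℕ → ℕ), (∀ n, y.1 n ∈ insert 1 T) ∧ b 0 = 0 ∧ Monotone b ∧
      Tendsto b atTop atTop ∧ x = y.blocks b := by
  choose l hl hlx using fun n => Submonoid.exists_list_of_mem_closure (hx n)
  -- The extra `1` makes every list nonempty, so that the concatenation is infinite.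
  obtain ⟨U, hU⟩ := exists_omegaConcat (fun n => 1 :: l n) fun n => List.cons_ne_nil _ _
  have hUT : ∀ m, U.get m ∈ insert 1 T := fun m => by
    obtain ⟨n, hn⟩ := hU.exists_mem m
    rcases List.mem_cons.1 hn with h | h
    · exact Or.inl h
    · exact Or.inr (hl n _ h)
  refine ⟨⟨U.get, .of_mem_finite (hT.insert 1) hUT⟩, _, hUT, rfl,
    OmegaConcat.monotone_length _, hU.tendsto_length, Subtype.ext (funext fun n => ?_)⟩
  show x.1 n = (List.map _ _).prod
  rw [← hU.eq_map_Ico n, List.prod_cons, one_mul, hlx]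

/-- Regrouping a sequence around infinitely many occurrences of `e`. -/
theorem exists_blocks_eq_mulRight {x : FinitarySeq S} {e : S} {M : Submonoid S}
    (hx : ∀ n, x.1 n ∈ M ∨ x.1 n = e) (hinf : {n | x.1 n ∉ M}.Infinite) :
    ∃ (b : ℕ → ℕ) (g : FinitarySeq S), b 0 = 0 ∧ Monotone b ∧ Tendsto b atTop atTop ∧
      (∀ n, g.1 n ∈ M) ∧ x.blocks b = g.mulRight e := by
  let p : ℕ → ℕ := Nat.nth fun n => x.1 n ∉ M
  have hpm : StrictMono p := Nat.nth_strictMono hinf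
  have hpe : ∀ k, x.1 (p k) = e := fun k => (hx _).resolve_left (Nat.nth_mem_of_infinite hinf k)
  -- Each block ends with the `k`-th term outside `M`, which is `e`; everything before it in the
  -- block lies in `M`.
  let b : ℕ → ℕ := fun k => Nat.casesOn k 0 fun k => p k + 1
  have hbs : ∀ k, b (k + 1) = p k + 1 := fun _ => rfl
  have hbp : ∀ k, b k ≤ p k := fun k => by
    cases k with
    | zero => exact Nat.zero_le _
    | succ k => exact hpm k.lt_succ_self
  have hbm : Monotone b := monotone_nat_of_le_succ fun k => (hbp k).trans (Nat.le_succ _)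
  have hbt : Tendsto b atTop atTop := by
    refine (tendsto_add_atTop_iff_nat 1).1 (tendsto_atTop_mono (fun k => ?_) tendsto_id)
    exact (hpm.le_apply).trans (Nat.le_succ _)
  have hnp : ∀ k n, b k ≤ n → n < p k → x.1 n ∈ M := by
    intro k n h1 h2
    by_contra hne
    have hr : n ∈ range p := by
      rw [Nat.range_nth_of_infinite hinf]; exact hne
    obtain ⟨j, rfl⟩ := hr
    have hjk : j < k := hpm.lt_iff_lt.1 h2
    obtain ⟨k, rfl⟩ : ∃ i, k = i + 1 := ⟨k - 1, by omega⟩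
    have := hpm.monotone (Nat.lt_succ_iff.1 hjk)
    rw [hbs] at h1
    omega
  refine ⟨b, ⟨fun k => ((List.Ico (b k) (p k)).map x.1).prod, x.2.list_prod_comp _⟩, rfl, hbm,
    hbt, fun k => list_prod_mem fun a ha => ?_, Subtype.ext (funext fun k => ?_)⟩
  · obtain ⟨n, hn, rfl⟩ := List.mem_map.1 ha
    obtain ⟨h1, h2⟩ := List.Ico.mem.1 hn
    exact hnp k n h1 h2
  · show ((List.Ico (b k) (b (k + 1))).map x.1).prod = _
    rw [hbs, List.Ico.succ_top (hbp k), List.map_append, List.prod_append, List.map_singleton,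
      List.prod_singleton, hpe]
    rfl

theorem of_drop {P : FinitarySeq S → Prop} (hshift : ∀ x : FinitarySeq S, P x.shift → P x)
    {x : FinitarySeq S} (m : ℕ) (h : P (x.drop m)) : P x := by
  induction m with
  | zero => exact h
  | succ m ih =>
    refine ih (hshift _ ?_)
    convert h using 1
    exact Subtype.ext (funext fun n => congrArg x.1 (by omega))

/-- Adjoining one more generator to those of the terms of a sequence. -/
theorem closure_insert_induction {P : FinitarySeq S → Prop}
    (hblocks : ∀ (x : FinitarySeq S) (b : ℕ → ℕ), b 0 = 0 → Monotone b →
      Tendsto b atTop atTop → (P x ↔ P (x.blocks b)))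
    (hshift : ∀ x : FinitarySeq S, P x.shift → P x) {T : Set S} (hT : T.Finite) {e : S}
    (h : ∀ x : FinitarySeq S, (∀ n, x.1 n ∈ Submonoid.closure T) → P x)
    (he : ∀ x : FinitarySeq S, (∀ n, x.1 n ∈ Submonoid.closure T) → P (x.mulRight e))
    {x : FinitarySeq S} (hx : ∀ n, x.1 n ∈ Submonoid.closure (insert e T)) : P x := by
  obtain ⟨y, b, hy, h0, hbm, hbt, rfl⟩ := exists_eq_blocks (hT.insert e) hx
  rw [← hblocks y b h0 hbm hbt]
  replace hy : ∀ n, y.1 n ∈ Submonoid.closure T ∨ y.1 n = e := fun n => by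
    rcases hy n with h | h | h
    · left; rw [h]; exact one_mem _
    · exact Or.inr h
    · exact Or.inl (Submonoid.subset_closure h)
  -- If `e` is needed infinitely often, regroup into terms `gₙ e`; otherwise a tail avoids it, and
  -- `hshift` restores the finitely many missing terms.
  by_cases hinf : {n | y.1 n ∉ Submonoid.closure T}.Infinite
  · obtain ⟨b, g, h0, hbm, hbt, hg, hb⟩ := exists_blocks_eq_mulRight hy hinf
    rw [hblocks y b h0 hbm hbt, hb]
    exact he g hg
  · obtain ⟨m, hm⟩ := (not_infinite.1 hinf).bddAbove
    refine of_drop hshift (m + 1) (h _ fun n => ?_)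
    by_contra hn
    have := hm (show n + (m + 1) ∈ {n | y.1 n ∉ Submonoid.closure T} from hn)
    omega

end FinitarySeq

/-! ### Induction on finitary sequences of regular languages -/

namespace RegLang

variable {A : Type u}

/-- The language denoted by a regular expression. -/
def ofRegex (r : RegularExpression A) : RegLang A := ⟨r.matches', r, rfl⟩

theorem exists_ofRegex (X : RegLang A) : ∃ r, ofRegex r = X :=
  let ⟨r, hr⟩ := X.2
  ⟨r, Subtype.ext hr⟩

/-- An induction principle for finitary sequences of regular languages. -/
theorem finitarySeq_induction {P : FinitarySeq (RegLang A) → Prop}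
    (hblocks : ∀ (x : FinitarySeq (RegLang A)) (b : ℕ → ℕ), b 0 = 0 → Monotone b →
      Tendsto b atTop atTop → (P x ↔ P (x.blocks b)))
    (hshift : ∀ x : FinitarySeq (RegLang A), P x.shift → P x)
    (hstar : ∀ (e : RegLang A) (x : FinitarySeq (RegLang A)),
      (∀ k : ℕ → ℕ, P (x.powMul e k)) → P (x.mulLeft (e∗)))
    (hadd : ∀ (e f : RegLang A) (x : FinitarySeq (RegLang A)),
      (∀ (c : ℕ → RegLang A) (hc : ∀ n, c n ∈ ({e, f} : Set (RegLang A))),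
        P (x.mulChoice e f c hc)) → P (x.mulRight (e + f)))
    (hzero : ∀ x : FinitarySeq (RegLang A), P (x.mulRight 0))
    (hletter : ∀ (F : Set A) (x : FinitarySeq (RegLang A)), F.Finite →
      (∀ n, x.1 n ∈ Submonoid.closure (letter '' F)) → P x)
    (x : FinitarySeq (RegLang A)) : P x := by
  -- `T` collects the generators still to be eliminated. Letters are kept apart in `F`, which is
  -- quantified here so that the letter case may enlarge it.
  let Q : Set (RegLang A) → Prop := fun T => ∀ (F : Set A) (x : FinitarySeq (RegLang A)),
    F.Finite → (∀ n, x.1 n ∈ Submonoid.closure (letter '' F ∪ T)) → P x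
  have hQmono : ∀ T T' : Set (RegLang A), T ⊆ Submonoid.closure T' → Q T' → Q T := by
    intro T T' h hQ F x hF hx
    refine hQ F x hF fun n => Submonoid.closure_le.2 ?_ (hx n)
    refine union_subset (subset_union_left.trans Submonoid.subset_closure) (h.trans ?_)
    exact Submonoid.closure_mono subset_union_right
  have hQins : ∀ T : Set (RegLang A), T.Finite → ∀ e, Q T →
      (∀ (F : Set A) (x : FinitarySeq (RegLang A)), F.Finite →
        (∀ n, x.1 n ∈ Submonoid.closure (letter '' F ∪ T)) → P (x.mulRight e)) →
      Q (insert e T) := by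
    intro T hT e hQ he F x hF hx
    rw [union_insert] at hx
    exact FinitarySeq.closure_insert_induction hblocks hshift ((hF.image _).union hT)
      (fun x hx => hQ F x hF hx) (fun x hx => he F x hF hx) hx
  -- Induction on `r` for all `T` at once: a compound expression is traded for its immediate
  -- subexpressions, which join `T` one after the other.
  have hQr : ∀ (r : RegularExpression A) (T : Set (RegLang A)), T.Finite → Q T →
      Q (insert (ofRegex r) T) := by
    intro r
    induction r with
    | zero => exact fun T hT hQ => hQins T hT _ hQ fun F x _ _ => hzero x
    | epsilon =>
      refine fun T _ hQ => hQmono _ T (insert_subset ?_ Submonoid.subset_closure) hQ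
      exact one_mem (Submonoid.closure T)
    | char a =>
      intro T _ hQ F x hF hx
      refine hQ (insert a F) x (hF.insert a) fun n => ?_
      rw [image_insert_eq, insert_union, ← union_insert]
      exact hx n
    | plus r t hr ht =>
      intro T hT hQ
      refine hQins T hT _ hQ fun F x hF hx => ?_
      refine hadd (ofRegex r) (ofRegex t) x fun c hc => ?_
      refine ht _ (hT.insert _) (hr T hT hQ) F _ hF fun n => mul_mem ?_ ?_
      · exact Submonoid.closure_mono (union_subset_union_right _
          ((subset_insert _ _).trans (subset_insert _ _))) (hx n)
      · refine Submonoid.subset_closure (Or.inr ?_)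
        rcases hc n with h | h
        · exact Or.inr (Or.inl h)
        · exact Or.inl h
    | comp r t hr ht =>
      intro T hT hQ
      refine hQmono _ (insert (ofRegex t) (insert (ofRegex r) T)) (insert_subset ?_ ?_)
        (ht _ (hT.insert _) (hr T hT hQ))
      · refine SetLike.mem_coe.2 (mul_mem (a := ofRegex r) (b := ofRegex t) ?_ ?_)
        · exact Submonoid.subset_closure (mem_insert_of_mem _ (mem_insert _ _))
        · exact Submonoid.subset_closure (mem_insert _ _)
      · exact ((subset_insert _ _).trans (subset_insert _ _)).trans Submonoid.subset_closure
    | star r hr =>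
      intro T hT hQ
      refine hQins T hT _ hQ fun F x hF hx => ?_
      have h2 : Tendsto (fun k : ℕ => 2 * k) atTop atTop :=
        tendsto_atTop_mono (fun k => by simp only [id]; omega) tendsto_id
      have h2m : Monotone fun k : ℕ => 2 * k := fun _ _ h => Nat.mul_le_mul_left 2 h
      -- The star stands on the right here, but on the left in `hstar`: regroup `(x₀ r∗)(x₁ r∗)⋯` as
      -- `x₀ (r∗ x₁)(r∗ x₂)⋯` and discard `x₀` by `hshift`.
      have e1 : x.mulRight (ofRegex r)∗ = x.mul (FinitarySeq.const (ofRegex r)∗) := rfl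
      show P (x.mulRight (ofRegex r)∗)
      rw [e1, ← FinitarySeq.interleave_blocks, ← hblocks _ _ rfl h2m h2]
      refine hshift _ ?_
      rw [FinitarySeq.interleave_shift, hblocks _ _ rfl h2m h2, FinitarySeq.interleave_blocks]
      refine hstar (ofRegex r) x.shift fun k => hr T hT hQ F _ hF fun n => mul_mem ?_ ?_
      · refine pow_mem (x := ofRegex r) ?_ (k n)
        exact Submonoid.subset_closure (mem_union_right _ (mem_insert _ _))
      · exact Submonoid.closure_mono (union_subset_union_right _ (subset_insert _ _)) (hx _)
  have hQfin : ∀ T : Set (RegLang A), T.Finite → Q T := by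
    intro T hT
    induction T, hT using Set.Finite.induction_on with
    | empty => exact fun F x hF hx => hletter F x hF (by simpa using hx)
    | @insert X T _ hT ih =>
      obtain ⟨r, rfl⟩ := exists_ofRegex X
      exact hQr r T hT ih
  obtain ⟨T, hT, hx⟩ := isFinitary_iff_closure.1 x.2
  exact hQfin T hT ∅ x finite_empty (by simpa using hx)

end RegLang

/-! ## The laws of `(R(A*), R'(A^ω))` -/

namespace RegLang

variable {A : Type u}

theorem le_iff {X Y : RegLang A} : X ≤ Y ↔ ∀ w ∈ X.lang, w ∈ Y.lang := by
  rw [← add_eq_right_iff_le]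
  constructor
  · intro h w hw
    have : w ∈ (X + Y).lang := (Language.mem_add X.lang Y.lang w).2 (Or.inl hw)
    rwa [h] at this
  · intro h
    refine Subtype.ext (Language.ext fun w => (Language.mem_add X.lang Y.lang w).trans ?_)
    exact ⟨fun h' => h'.elim (h w) id, Or.inr⟩

theorem mem_add {X Y : RegLang A} {w : List A} :
    w ∈ (X + Y).lang ↔ w ∈ X.lang ∨ w ∈ Y.lang := Language.mem_add X.lang Y.lang w

theorem mem_mul {X Y : RegLang A} {w : List A} :
    w ∈ (X * Y).lang ↔ ∃ a ∈ X.lang, ∃ b ∈ Y.lang, a ++ b = w :=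
  Language.mem_mul (l := X.lang) (m := Y.lang)

theorem mem_one {w : List A} : w ∈ (1 : RegLang A).lang ↔ w = [] := Language.mem_one w

theorem notMem_zero (w : List A) : w ∉ (0 : RegLang A).lang := Language.notMem_zero w

theorem mem_letter {a : A} {w : List A} : w ∈ (letter a).lang ↔ w = [a] := Iff.rfl

theorem lang_pow (X : RegLang A) (n : ℕ) : (X ^ n).lang = X.lang ^ n := by
  induction n with
  | zero => rfl
  | succ n ih => rw [pow_succ, pow_succ, ← ih]; rfl

theorem mem_kstar {X : RegLang A} {w : List A} : w ∈ X∗.lang ↔ ∃ n : ℕ, w ∈ (X ^ n).lang := by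
  simp only [lang_pow]
  show w ∈ X.lang∗ ↔ _
  rw [Language.kstar_eq_iSup_pow]
  exact Language.mem_iSup

instance : IsStarContinuous (RegLang A) where
  isLUB_mul_pow_mul X Y Z := by
    refine ⟨?_, fun U hU => le_iff.2 fun w hw => ?_⟩
    · rintro _ ⟨n, rfl⟩
      refine le_iff.2 fun w hw => ?_
      obtain ⟨_, hab, c, hc, rfl⟩ := mem_mul.1 hw
      obtain ⟨a, ha, b, hb, rfl⟩ := mem_mul.1 hab
      exact mem_mul.2 ⟨_, mem_mul.2 ⟨a, ha, b, mem_kstar.2 ⟨n, hb⟩, rfl⟩, c, hc, rfl⟩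
    · obtain ⟨_, hab, c, hc, rfl⟩ := mem_mul.1 hw
      obtain ⟨a, ha, b, hb, rfl⟩ := mem_mul.1 hab
      obtain ⟨n, hn⟩ := mem_kstar.1 hb
      exact le_iff.1 (hU ⟨n, rfl⟩) _
        (mem_mul.2 ⟨_, mem_mul.2 ⟨a, ha, b, hn, rfl⟩, c, hc, rfl⟩)

end RegLang

namespace RegOmega

variable {A : Type u}

open RegLang

theorem le_iff {Z W : RegOmega A} : Z ≤ W ↔ ∀ s ∈ Z.1, s ∈ W.1 := Iff.rfl

theorem mem_sup {Z W : RegOmega A} {s : Stream' A} : s ∈ (Z ⊔ W).1 ↔ s ∈ Z.1 ∨ s ∈ W.1 :=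
  Iff.rfl

theorem notMem_bot (s : Stream' A) : s ∉ (⊥ : RegOmega A).1 := fun h => h

theorem ext_iff_mem {Z W : RegOmega A} : Z = W ↔ ∀ s, s ∈ Z.1 ↔ s ∈ W.1 :=
  ⟨fun h _ => h ▸ Iff.rfl, fun h => Subtype.ext (Set.ext h)⟩

theorem mem_smul {X : RegLang A} {Z : RegOmega A} {s : Stream' A} :
    s ∈ (X • Z).1 ↔ ∃ x ∈ X.lang, ∃ z ∈ Z.1, s = Stream'.appendStream' x z := Iff.rfl

theorem mem_infProd {X : FinitarySeq (RegLang A)} {s : Stream' A} :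
    s ∈ (infProd (RegOmega A) X).1 ↔
      ∃ u : ℕ → List A, (∀ n, u n ∈ (X.1 n).lang) ∧ OmegaConcat u s := Iff.rfl

theorem infProd_eq_smul (X : FinitarySeq (RegLang A)) :
    infProd (RegOmega A) X = X.1 0 • infProd (RegOmega A) X.shift := by
  refine ext_iff_mem.2 fun s => ?_
  rw [mem_smul, mem_infProd]
  constructor
  · rintro ⟨u, hu, hus⟩
    obtain ⟨t, rfl, ht⟩ := (omegaConcat_cons_iff u s).1 hus
    exact ⟨u 0, hu 0, t, ⟨fun n => u (n + 1), fun n => hu (n + 1), ht⟩, rfl⟩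
  · rintro ⟨x, hx, z, ⟨u, hu, huz⟩, rfl⟩
    refine ⟨fun n => Nat.casesOn n x u, fun n => ?_, ?_⟩
    · cases n with
      | zero => exact hx
      | succ n => exact hu n
    · exact (omegaConcat_cons_iff _ _).2 ⟨z, rfl, huz⟩

theorem infProd_blocks (X : FinitarySeq (RegLang A)) {b : ℕ → ℕ} (h0 : b 0 = 0)
    (hb : Monotone b) (ht : Tendsto b atTop atTop) :
    infProd (RegOmega A) X = infProd (RegOmega A) (X.blocks b) := by
  refine ext_iff_mem.2 fun s => ?_
  rw [mem_infProd, mem_infProd]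
  constructor
  · rintro ⟨u, hu, hus⟩
    refine ⟨fun k => ((List.Ico (b k) (b (k + 1))).map u).flatten, fun k => ?_,
      (omegaConcat_flatten_iff (OmegaConcat.of_Ico (s := u) h0 hb ht) s).2 hus⟩
    refine (mem_lang_list_prod _ _).2 ⟨_, ?_, rfl⟩
    rw [List.forall₂_map_left_iff, List.forall₂_map_right_iff, List.forall₂_same]
    exact fun n _ => hu n
  · rintro ⟨v, hv, hvs⟩
    choose l hl hlv using fun k => (mem_lang_list_prod _ _).1 (hv k)
    -- Factorizations of the block words, chosen separately, combine into one sequence of words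
    -- parallel to `X`; empty blocks contribute empty lists.
    obtain ⟨U, hlU, hU⟩ := (OmegaConcat.of_Ico (s := X.1) h0 hb ht).exists_forall₂ hl
    obtain rfl : (fun k => (l k).flatten) = v := funext hlv
    exact ⟨U.get, hU, (omegaConcat_flatten_iff hlU s).1 hvs⟩

theorem mem_infProd_mulRight_add {X : FinitarySeq (RegLang A)} {Y Z : RegLang A}
    {s : Stream' A} (hs : s ∈ (infProd (RegOmega A) (X.mulRight (Y + Z))).1) :
    ∃ (c : ℕ → RegLang A) (hc : ∀ n, c n ∈ ({Y, Z} : Set (RegLang A))),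
      s ∈ (infProd (RegOmega A) (X.mulChoice Y Z c hc)).1 := by
  obtain ⟨u, hu, hus⟩ := hs
  have key : ∀ n, ∃ C ∈ ({Y, Z} : Set (RegLang A)), u n ∈ (X.1 n * C).lang := by
    intro n
    obtain ⟨a, ha, b, hb, e⟩ := mem_mul.1 (hu n)
    rcases mem_add.1 hb with hb | hb
    · exact ⟨Y, Or.inl rfl, mem_mul.2 ⟨a, ha, b, hb, e⟩⟩
    · exact ⟨Z, Or.inr rfl, mem_mul.2 ⟨a, ha, b, hb, e⟩⟩
  choose c hc hcu using key
  exact ⟨c, hc, u, hcu, hus⟩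

theorem mem_infProd_mulLeft_kstar {X : RegLang A} {Y : FinitarySeq (RegLang A)}
    {s : Stream' A} (hs : s ∈ (infProd (RegOmega A) (Y.mulLeft (X∗))).1) :
    ∃ k : ℕ → ℕ, s ∈ (infProd (RegOmega A) (Y.powMul X k)).1 := by
  obtain ⟨u, hu, hus⟩ := hs
  have key : ∀ n, ∃ k : ℕ, u n ∈ (X ^ k * Y.1 n).lang := by
    intro n
    obtain ⟨a, ha, b, hb, e⟩ := mem_mul.1 (hu n)
    obtain ⟨k, hk⟩ := mem_kstar.1 ha
    exact ⟨k, mem_mul.2 ⟨a, hk, b, hb, e⟩⟩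
  choose k hk using key
  exact ⟨k, u, hk, hus⟩

theorem infProd_mono {X Y : FinitarySeq (RegLang A)} (h : ∀ n, X.1 n ≤ Y.1 n) :
    infProd (RegOmega A) X ≤ infProd (RegOmega A) Y := by
  rintro s ⟨u, hu, hus⟩
  exact ⟨u, fun n => RegLang.le_iff.1 (h n) _ (hu n), hus⟩

theorem smul_mono_left {X Y : RegLang A} (h : X ≤ Y) (Z : RegOmega A) : X • Z ≤ Y • Z := by
  rintro s ⟨x, hx, z, hz, rfl⟩
  exact ⟨x, RegLang.le_iff.1 h x hx, z, hz, rfl⟩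

theorem pow_le_kstar (X : RegLang A) (n : ℕ) : X ^ n ≤ X∗ :=
  RegLang.le_iff.2 fun _ h => mem_kstar.2 ⟨n, h⟩

theorem isFinitaryKleeneOmegaAlgebra :
    IsFinitaryKleeneOmegaAlgebra (RegLang A) (RegOmega A) where
  toIsStarContinuous := inferInstance
  add_smul X Y Z := by
    refine ext_iff_mem.2 fun s => ?_
    simp only [mem_sup, mem_smul, RegLang.mem_add, or_and_right, exists_or]
  smul_sup X Z W := by
    refine ext_iff_mem.2 fun s => ?_
    simp only [mem_sup, mem_smul, or_and_right, exists_or, and_or_left]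
  mul_smul X Y Z := by
    refine ext_iff_mem.2 fun s => ?_
    constructor
    · rintro ⟨_, h, z, hz, rfl⟩
      obtain ⟨x, hx, y, hy, rfl⟩ := RegLang.mem_mul.1 h
      exact ⟨x, hx, _, ⟨y, hy, z, hz, rfl⟩, Stream'.append_append_stream _ _ _⟩
    · rintro ⟨x, hx, _, ⟨y, hy, z, hz, rfl⟩, rfl⟩
      exact ⟨x ++ y, RegLang.mem_mul.2 ⟨x, hx, y, hy, rfl⟩, z, hz,
        (Stream'.append_append_stream _ _ _).symm⟩
  zero_smul Z := ext_iff_mem.2 fun s =>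
    ⟨fun ⟨x, hx, _⟩ => (RegLang.notMem_zero x hx).elim, fun h => (notMem_bot s h).elim⟩
  smul_bot X := ext_iff_mem.2 fun s =>
    ⟨fun ⟨_, _, z, hz, _⟩ => (notMem_bot z hz).elim, fun h => (notMem_bot s h).elim⟩
  one_smul Z := by
    refine ext_iff_mem.2 fun s => ⟨?_, fun hs => ⟨[], RegLang.mem_one.2 rfl, s, hs, rfl⟩⟩
    rintro ⟨x, hx, z, hz, rfl⟩
    rw [RegLang.mem_one.1 hx]
    exact hz
  isLUB_mul_pow_smul X Y Z := by
    refine ⟨?_, fun W hW => ?_⟩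
    · rintro _ ⟨n, rfl⟩
      exact smul_mono_left (mul_le_mul_right (pow_le_kstar Y n) X) Z
    · rintro s ⟨_, h, z, hz, rfl⟩
      obtain ⟨x, hx, y, hy, rfl⟩ := RegLang.mem_mul.1 h
      obtain ⟨n, hn⟩ := mem_kstar.1 hy
      exact hW ⟨n, rfl⟩ ⟨_, RegLang.mem_mul.2 ⟨x, hx, y, hn, rfl⟩, z, hz, rfl⟩
  infProd_eq_smul := infProd_eq_smul
  infProd_blocks X b h0 hb ht := infProd_blocks X h0 hb ht
  isLUB_infProd_add X Y Z := by
    refine ⟨?_, fun W hW s hs => ?_⟩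
    · rintro _ ⟨c, hc, rfl⟩
      refine infProd_mono fun n => mul_le_mul_right ?_ (X.1 n)
      rcases hc n with h | h
      · rw [h, add_eq_sup]; exact le_sup_left
      · rw [h, add_eq_sup]; exact le_sup_right
    · obtain ⟨c, hc, h⟩ := mem_infProd_mulRight_add hs
      exact hW ⟨c, hc, rfl⟩ h
  isLUB_infProd_star X Y := by
    refine ⟨?_, fun W hW s hs => ?_⟩
    · rintro _ ⟨k, rfl⟩
      exact infProd_mono fun n => mul_le_mul_left (pow_le_kstar X (k n)) (Y.1 n)
    · obtain ⟨k, h⟩ := mem_infProd_mulLeft_kstar hs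
      exact hW ⟨k, rfl⟩ h

theorem omegaPow_one : omegaPow (RegOmega A) (1 : RegLang A) = ⊥ := by
  refine ext_iff_mem.2 fun s => ⟨?_, fun h => (notMem_bot s h).elim⟩
  rintro ⟨u, hu, hus⟩
  exfalso
  have h0 : ∀ n, prefixWord u n = [] := by
    intro n
    induction n with
    | zero => rfl
    | succ n ih => rw [prefixWord_succ, ih, RegLang.mem_one.1 (hu n)]; rfl
  obtain ⟨n, hn⟩ := hus.2 1
  rw [h0 n] at hn
  simp at hn

/-- Every element of `R'(A^ω)` is a finite join of infinite products. -/
theorem induction {P : RegOmega A → Prop} (hbot : P ⊥)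
    (hprod : ∀ x : FinitarySeq (RegLang A), P (infProd (RegOmega A) x))
    (hsup : ∀ Z W, P Z → P W → P (Z ⊔ W)) (Z : RegOmega A) : P Z := by
  obtain ⟨_, _, ⟨k, R, hR, rfl⟩, rfl⟩ := Z
  have key : ∀ (k : ℕ) (R : Fin k → ℕ → RegLang A) (_ : ∀ i, (range (R i)).Finite)
      (Z : RegOmega A), Z.1 = ⋃ i, omegaPart (inftyProd (R i)) → P Z := by
    intro k
    induction k with
    | zero =>
      intro R _ Z hZ
      have : Z = ⊥ := Subtype.ext (hZ.trans (iUnion_of_empty _))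
      rwa [this]
    | succ k ih =>
      intro R hR Z hZ
      let x : FinitarySeq (RegLang A) :=
        ⟨R 0, .of_mem_finite (hR 0) fun n => mem_range_self n⟩
      let W : RegOmega A := ⟨⋃ i : Fin k, omegaPart (inftyProd (R i.succ)),
        _, ⟨k, fun i => R i.succ, fun i => hR _, rfl⟩, omegaPart_iUnion _⟩
      have : Z = infProd (RegOmega A) x ⊔ W := by
        refine ext_iff_mem.2 fun s => ?_
        rw [hZ, mem_iUnion, Fin.exists_fin_succ, mem_sup]
        exact or_congr Iff.rfl mem_iUnion.symm
      rw [this]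
      exact hsup _ _ (hprod x) (ih _ (fun i => hR _) W rfl)
  exact key k R hR _ (omegaPart_iUnion _)

end RegOmega

/-! ## Evaluation of regular languages -/

/-- A supremum of suprema, in an order where only certain suprema exist. -/
theorem IsLUB.of_forall_isLUB {α : Type*} [Preorder α] {s t : Set α} {a : α} (hs : IsLUB s a)
    (h1 : ∀ b ∈ s, ∃ t' ⊆ t, IsLUB t' b) (h2 : ∀ c ∈ t, ∃ b ∈ s, c ≤ b) : IsLUB t a := by
  refine ⟨fun c hc => ?_, fun d hd => hs.2 fun b hb => ?_⟩
  · obtain ⟨b, hb, hcb⟩ := h2 c hc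
    exact hcb.trans (hs.1 hb)
  · obtain ⟨t', ht', h⟩ := h1 b hb
    exact h.2 fun c hc => hd (ht' hc)

section Evaluation

variable {A : Type*} {S : Type*} [IdemSemiring S] [KStar S]

/-- The value of a finite word. -/
def wordVal (h : A → S) (w : List A) : S := (w.map h).prod

theorem wordVal_append (h : A → S) (w w' : List A) :
    wordVal h (w ++ w') = wordVal h w * wordVal h w' := by simp [wordVal]

/-- The value of a regular expression. -/
def regEval (h : A → S) : RegularExpression A → S
  | .zero => 0
  | .epsilon => 1
  | .char a => h a
  | .plus r t => regEval h r + regEval h t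
  | .comp r t => regEval h r * regEval h t
  | .star r => (regEval h r)∗

/-- For the action `act` of `S`, `s e m` is the least upper bound of the `s w m`, where `w` runs
over the values of the words in `L`. -/
def IsActLUB {M : Type*} [Preorder M] (act : S → M → M) (h : A → S) (L : Language A) (e : S) :
    Prop :=
  ∀ (s : S) (m : M), IsLUB {b | ∃ w ∈ L, act (s * wordVal h w) m = b} (act (s * e) m)

theorem IsActLUB.one {M : Type*} [Preorder M] (act : S → M → M) (h : A → S) :
    IsActLUB act h 1 1 := by
  intro s m
  convert isLUB_singleton (a := act (s * 1) m) using 1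
  ext b
  simp [Language.mem_one, wordVal, eq_comm]

/-- First expand `f` behind `s e`, then `e` in front of each fixed word of `K`, which is absorbed
into `m`. This is why the property quantifies over both sides. -/
theorem IsActLUB.mul {M : Type*} [Preorder M] {act : S → M → M} {h : A → S}
    (hmul : ∀ s t m, act (s * t) m = act s (act t m)) {L K : Language A} {e f : S}
    (hL : IsActLUB act h L e) (hK : IsActLUB act h K f) : IsActLUB act h (L * K) (e * f) := by
  intro s m
  rw [← mul_assoc]
  refine (hK (s * e) m).of_forall_isLUB ?_ ?_
  · rintro _ ⟨w, hw, rfl⟩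
    rw [hmul]
    refine ⟨_, ?_, hL s (act (wordVal h w) m)⟩
    rintro _ ⟨w', hw', rfl⟩
    exact ⟨w' ++ w, Language.append_mem_mul hw' hw, by rw [wordVal_append, ← mul_assoc, hmul]⟩
  · rintro _ ⟨_, hw, rfl⟩
    obtain ⟨w', hw', w, hwK, rfl⟩ := Language.mem_mul.1 hw
    refine ⟨_, ⟨w, hwK, rfl⟩, ?_⟩
    rw [wordVal_append, ← mul_assoc, hmul, hmul (s * e)]
    exact (hL s _).1 ⟨w', hw', rfl⟩

theorem IsActLUB.pow {M : Type*} [Preorder M] {act : S → M → M} {h : A → S}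
    (hmul : ∀ s t m, act (s * t) m = act s (act t m)) {L : Language A} {e : S}
    (hL : IsActLUB act h L e) (n : ℕ) : IsActLUB act h (L ^ n) (e ^ n) := by
  induction n with
  | zero => simpa using IsActLUB.one act h
  | succ n ih => rw [pow_succ, pow_succ]; exact ih.mul hmul hL

/-- Stated for an abstract action so as to serve both for multiplication in `S` and for the action
on `V`. -/
theorem isActLUB_regEval {M : Type*} [SemilatticeSup M] [OrderBot M] {act : S → M → M}
    (hzero : ∀ m, act 0 m = ⊥) (hadd : ∀ s t m, act (s + t) m = act s m ⊔ act t m)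
    (hmul : ∀ s t m, act (s * t) m = act s (act t m))
    (hstar : ∀ x y m, IsLUB (range fun n : ℕ => act (x * y ^ n) m) (act (x * y∗) m))
    (h : A → S) (r : RegularExpression A) : IsActLUB act h r.matches' (regEval h r) := by
  induction r with
  | zero =>
    intro s m
    have : {b | ∃ w ∈ (0 : Language A), act (s * wordVal h w) m = b} = ∅ := by
      ext b
      simp [Language.notMem_zero]
    show IsLUB {b | ∃ w ∈ (0 : Language A), _} (act (s * 0) m)
    rw [this, mul_zero, hzero]
    exact isLUB_empty
  | epsilon => exact IsActLUB.one act h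
  | char a =>
    intro s m
    show IsLUB _ (act (s * h a) m)
    convert isLUB_singleton (a := act (s * h a) m) using 1
    ext b
    show (∃ w, w = [a] ∧ _) ↔ _
    simp [wordVal, eq_comm]
  | plus r t hr ht =>
    intro s m
    show IsLUB _ (act (s * (regEval h r + regEval h t)) m)
    rw [mul_add, hadd]
    convert (hr s m).union (ht s m) using 1
    ext b
    show (∃ w, (w ∈ r.matches' ∨ w ∈ t.matches') ∧ _) ↔
      (∃ w, w ∈ r.matches' ∧ _) ∨ (∃ w, w ∈ t.matches' ∧ _)
    simp only [or_and_right, exists_or]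
  | comp r t hr ht => exact hr.mul hmul ht
  | star r hr =>
    intro s m
    have hmem : ∀ w, w ∈ (RegularExpression.star r).matches' ↔ ∃ n : ℕ, w ∈ r.matches' ^ n := by
      intro w
      show w ∈ r.matches'∗ ↔ _
      rw [Language.kstar_eq_iSup_pow]
      exact Language.mem_iSup
    refine (hstar s (regEval h r) m).of_forall_isLUB ?_ ?_
    · rintro _ ⟨n, rfl⟩
      refine ⟨_, ?_, hr.pow hmul n s m⟩
      rintro _ ⟨w, hw, rfl⟩
      exact ⟨w, (hmem w).2 ⟨n, hw⟩, rfl⟩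
    · rintro _ ⟨w, hw, rfl⟩
      obtain ⟨n, hw⟩ := (hmem w).1 hw
      exact ⟨_, ⟨n, rfl⟩, (hr.pow hmul n s m).1 ⟨w, hw, rfl⟩⟩

theorem regEval_congr [IsStarContinuous S] (h : A → S) {r t : RegularExpression A}
    (hrt : r.matches' = t.matches') : regEval h r = regEval h t := by
  have key := isActLUB_regEval (M := S) (act := (· * ·))
    (fun m => (zero_mul m).trans bot_eq_zero.symm)
    (fun s t m => (add_mul s t m).trans (add_eq_sup _ _)) mul_assoc
    IsStarContinuous.isLUB_mul_pow_mul h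
  have h1 := key r 1 1
  rw [hrt] at h1
  simpa using h1.unique (key t 1 1)

end Evaluation

/-! ### Homomorphisms on regular languages, words and derivatives -/

namespace RegLang

variable {A : Type u} {S : Type*} [IdemSemiring S] [KStar S]

/-- The homomorphic extension of a map on letters to regular languages. -/
noncomputable def lift [IsStarContinuous S] (h : A → S) : RegLang A →+* S :=
  -- The value does not depend on the chosen expression.
  have key : ∀ r, regEval h (exists_ofRegex (ofRegex r)).choose = regEval h r := fun r =>
    regEval_congr h (Subtype.ext_iff.1 (exists_ofRegex (ofRegex r)).choose_spec)
  { toFun X := regEval h (exists_ofRegex X).choose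
    map_one' := key .epsilon
    map_zero' := key .zero
    map_mul' X Y := by
      obtain ⟨r, rfl⟩ := exists_ofRegex X
      obtain ⟨t, rfl⟩ := exists_ofRegex Y
      rw [key r, key t]
      exact key (.comp r t)
    map_add' X Y := by
      obtain ⟨r, rfl⟩ := exists_ofRegex X
      obtain ⟨t, rfl⟩ := exists_ofRegex Y
      rw [key r, key t]
      exact key (.plus r t) }

theorem lift_ofRegex [IsStarContinuous S] (h : A → S) (r : RegularExpression A) :
    lift h (ofRegex r) = regEval h r :=
  regEval_congr h (Subtype.ext_iff.1 (exists_ofRegex (ofRegex r)).choose_spec)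

theorem lift_letter [IsStarContinuous S] (h : A → S) (a : A) : lift h (letter a) = h a :=
  lift_ofRegex h (.char a)

theorem lift_kstar [IsStarContinuous S] (h : A → S) (X : RegLang A) :
    lift h X∗ = (lift h X)∗ := by
  obtain ⟨r, rfl⟩ := exists_ofRegex X
  rw [lift_ofRegex]
  exact lift_ofRegex h (.star r)

theorem map_ofRegex {φ : RegLang A →+* S} (hφ : ∀ X, φ X∗ = (φ X)∗) (r : RegularExpression A) :
    φ (ofRegex r) = regEval (fun a => φ (letter a)) r := by
  induction r with
  | zero => exact map_zero φ
  | epsilon => exact map_one φ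
  | char a => rfl
  | plus r t hr ht => exact (map_add φ (ofRegex r) (ofRegex t)).trans (by rw [hr, ht]; rfl)
  | comp r t hr ht => exact (map_mul φ (ofRegex r) (ofRegex t)).trans (by rw [hr, ht]; rfl)
  | star r hr => exact (hφ (ofRegex r)).trans (by rw [hr]; rfl)

theorem map_mono (φ : RegLang A →+* S) {X Y : RegLang A} (h : X ≤ Y) : φ X ≤ φ Y := by
  rw [← add_eq_right_iff_le] at h ⊢
  rw [← map_add, h]

/-- The language `{w}`. -/
def word (w : List A) : RegLang A := (w.map letter).prod

theorem mem_word {w v : List A} : v ∈ (word w).lang ↔ v = w := by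
  induction w generalizing v with
  | nil => exact mem_one
  | cons a w ih =>
    show v ∈ (List.prod (letter a :: w.map letter)).lang ↔ _
    rw [List.prod_cons, mem_mul]
    constructor
    · rintro ⟨x, hx, y, hy, rfl⟩
      rw [mem_letter.1 hx, ih.1 hy]
      rfl
    · rintro rfl
      exact ⟨[a], rfl, w, ih.2 rfl, rfl⟩

theorem map_word (φ : RegLang A →+* S) (w : List A) :
    φ (word w) = wordVal (fun a => φ (letter a)) w := by
  rw [word, map_list_prod, List.map_map]
  rfl

theorem wordVal_le (φ : RegLang A →+* S) {X : RegLang A} {w : List A} (h : w ∈ X.lang) :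
    wordVal (fun a => φ (letter a)) w ≤ φ X := by
  rw [← map_word]
  exact map_mono φ (le_iff.2 fun v hv => by rwa [mem_word.1 hv])

/-- Brzozowski derivatives keep left quotients by letters regular. -/
theorem exists_deriv (a : A) (X : RegLang A) :
    ∃ D : RegLang A, ∀ t, t ∈ D.lang ↔ a :: t ∈ X.lang := by
  classical
  obtain ⟨r, rfl⟩ := exists_ofRegex X
  refine ⟨ofRegex (r.deriv a), fun t => ?_⟩
  show t ∈ (r.deriv a).matches' ↔ a :: t ∈ r.matches'
  rw [← RegularExpression.rmatch_iff_matches', ← RegularExpression.rmatch_iff_matches']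
  rfl

theorem exists_word_of_mem_closure {F : Set A} {X : RegLang A}
    (hX : X ∈ Submonoid.closure (letter '' F)) : ∃ w : List A, (∀ a ∈ w, a ∈ F) ∧ X = word w := by
  induction hX using Submonoid.closure_induction with
  | mem _ h =>
    obtain ⟨a, ha, rfl⟩ := h
    exact ⟨[a], by simpa using ha, by simp [word]⟩
  | one => exact ⟨[], by simp, rfl⟩
  | mul _ _ _ _ h1 h2 =>
    obtain ⟨w1, h1, rfl⟩ := h1
    obtain ⟨w2, h2, rfl⟩ := h2
    refine ⟨w1 ++ w2, fun a ha => ?_, by simp [word]⟩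
    exact (List.mem_append.1 ha).elim (h1 a) (h2 a)

end RegLang

namespace FinitarySeq

variable {S : Type*} [Monoid S]

/-- The sequence `a, x₀, x₁, …`. -/
def cons (a : S) (x : FinitarySeq S) : FinitarySeq S :=
  ⟨fun n => Nat.casesOn n a x.1, by
    obtain ⟨F, hF, hx⟩ := isFinitary_iff_closure.1 x.2
    refine isFinitary_iff_closure.2 ⟨insert a F, hF.insert a, fun n => ?_⟩
    cases n with
    | zero => exact Submonoid.subset_closure (mem_insert _ _)
    | succ n => exact Submonoid.closure_mono (subset_insert _ _) (hx n)⟩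

end FinitarySeq

theorem infProd_congr {S V : Type*} [Monoid S] [FinitaryOmegaOps S V] {x y : FinitarySeq S}
    (h : ∀ n, x.1 n = y.1 n) : infProd V x = infProd V y :=
  congrArg _ (Subtype.ext (funext h))

/-! ### Consequences of the laws for infinite products -/

namespace IsFinitaryKleeneOmegaAlgebra

variable {S : Type*} {V : Type*} [IdemSemiring S] [KStar S] [SemilatticeSup V] [OrderBot V]
  [FinitaryOmegaOps S V] (H : IsFinitaryKleeneOmegaAlgebra S V)

include H

theorem smul_le_smul {s t : S} {v w : V} (hst : s ≤ t) (hvw : v ≤ w) : s • v ≤ t • w := by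
  have h1 : s • v ≤ s • w := by
    rw [← sup_eq_right, ← H.smul_sup, sup_eq_right.2 hvw]
  have h2 : s • w ≤ t • w := by
    rw [← sup_eq_right, ← H.add_smul, add_eq_right_iff_le.2 hst]
  exact h1.trans h2

theorem infProd_cons (a : S) (x : FinitarySeq S) :
    infProd V (x.cons a) = a • infProd V x := H.infProd_eq_smul (x.cons a)

theorem infProd_eq_prod_smul (x : FinitarySeq S) (m : ℕ) :
    infProd V x = ((List.range m).map x.1).prod • infProd V (x.drop m) := by
  induction m with
  | zero => simp only [List.range_zero, List.map_nil, List.prod_nil, H.one_smul]; rfl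
  | succ m ih =>
    rw [ih, H.infProd_eq_smul (x.drop m), ← H.mul_smul, List.range_succ, List.map_append,
      List.prod_append]
    congr 1
    · simp [FinitarySeq.drop]
    · exact infProd_congr fun n => congrArg x.1 (by omega)

theorem infProd_eq_infProd_of_omegaConcat {l : ℕ → List S} {x y : FinitarySeq S}
    (h : OmegaConcat l x.1) (hy : ∀ n, y.1 n = (l n).prod) : infProd V x = infProd V y := by
  rw [H.infProd_blocks x _ rfl (OmegaConcat.monotone_length l) h.tendsto_length]
  refine infProd_congr fun n => ?_
  rw [hy, h.eq_map_Ico n]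
  rfl

theorem infProd_drop_le {x : FinitarySeq S} {m : ℕ} (h : ∀ n < m, 1 ≤ x.1 n) :
    infProd V (x.drop m) ≤ infProd V x := by
  have key : 1 ≤ ((List.range m).map x.1).prod := by
    induction m with
    | zero => simp
    | succ m ih =>
      rw [List.range_succ, List.map_append, List.prod_append, List.map_singleton,
        List.prod_singleton]
      calc (1 : S) = 1 * 1 := (one_mul 1).symm
        _ ≤ _ := mul_le_mul' (ih fun n hn => h n (by omega)) (h m (by omega))
  rw [H.infProd_eq_prod_smul x m]
  nth_rewrite 1 [← H.one_smul (infProd V (x.drop m))]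
  exact H.smul_le_smul key le_rfl

/-- The product is a finite product acting on `1^ω`. This is where the extra axiom takes effect. -/
theorem infProd_eq_bot_of_eventually_one (h1 : omegaPow V (1 : S) = ⊥) {x : FinitarySeq S}
    {N : ℕ} (hx : ∀ n, N ≤ n → x.1 n = 1) : infProd V x = ⊥ := by
  have : infProd V (x.drop N) = omegaPow V (1 : S) :=
    infProd_congr fun n => hx (n + N) (by omega)
  rw [H.infProd_eq_prod_smul x N, this, h1, H.smul_bot]

end IsFinitaryKleeneOmegaAlgebra

theorem exists_omegaConcat_or_eventually_nil {A : Type*} (u : ℕ → List A) :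
    (∃ s, OmegaConcat u s) ∨ ∃ N, ∀ n, N ≤ n → u n = [] := by
  by_cases h : ∃ N, ∀ n, N ≤ n → u n = []
  · exact Or.inr h
  push Not at h
  refine Or.inl (exists_omegaConcat_of_unbounded u fun m => ?_)
  induction m with
  | zero => exact ⟨0, Nat.zero_le _⟩
  | succ m ih =>
    obtain ⟨n, hn⟩ := ih
    obtain ⟨k, hnk, hk⟩ := h n
    refine ⟨k + 1, ?_⟩
    have h1 := (prefixWord_prefix u hnk).length_le
    have h2 := List.length_pos_iff.2 hk
    rw [prefixWord_succ, List.length_append]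
    omega

theorem OmegaConcat.eventually_ne_nil {A : Type*} {u : ℕ → List A} {s : Stream' A}
    (h : OmegaConcat u s) : ∃ n, u n ≠ [] := by
  by_contra! hu
  obtain ⟨n, hn⟩ := h.2 1
  have : prefixWord u n = [] := by
    induction n with
    | zero => rfl
    | succ n ih =>
      simp [prefixWord, hu]
  simp [this] at hn

theorem OmegaConcat.unique {A : Type*} {u : ℕ → List A} {s t : Stream' A}
    (hs : OmegaConcat u s) (ht : OmegaConcat u t) : s = t := by
  ext m
  obtain ⟨n, hn⟩ := hs.2 (m + 1)
  have h := (hs.1 n).symm.trans (ht.1 n)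
  have h1 := Stream'.getElem?_take (s := s) (show m < (prefixWord u n).length by omega)
  rw [h, Stream'.getElem?_take (by omega)] at h1
  exact (Option.some.inj h1).symm

/-! ## The values of elements of `R'(A^ω)` -/

section Values

variable {A : Type u} {S : Type v} {V : Type w} [IdemSemiring S] [KStar S] [SemilatticeSup V]
  [OrderBot V] [FinitaryOmegaOps S V] (φ : RegLang A →+* S)

/-- The infinite product of the values of the letters of `s` is `b`. -/
def IsStreamValue (s : Stream' A) (b : V) : Prop :=
  ∃ hs : IsFinitary fun n => φ (RegLang.letter (s.get n)), infProd V ⟨_, hs⟩ = b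

/-- The values of finite joins of infinite products. -/
inductive IsValue : RegOmega A → V → Prop
  | bot : IsValue ⊥ ⊥
  | infProd (x : FinitarySeq (RegLang A)) :
      IsValue (_root_.infProd (RegOmega A) x) (_root_.infProd V (x.map (φ : RegLang A →* S)))
  | sup {Z W b c} : IsValue Z b → IsValue W c → IsValue (Z ⊔ W) (b ⊔ c)

theorem exists_isValue (Z : RegOmega A) : ∃ b : V, IsValue φ Z b := by
  induction Z using RegOmega.induction with
  | hbot => exact ⟨_, .bot⟩
  | hprod x => exact ⟨_, .infProd x⟩
  | hsup Z W hZ hW =>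
    obtain ⟨b, hb⟩ := hZ
    obtain ⟨c, hc⟩ := hW
    exact ⟨_, hb.sup hc⟩

theorem map_blocks (x : FinitarySeq (RegLang A)) (b : ℕ → ℕ) :
    (x.blocks b).map (φ : RegLang A →* S) = (x.map (φ : RegLang A →* S)).blocks b := by
  refine Subtype.ext (funext fun n => ?_)
  show φ (List.prod _) = List.prod _
  rw [map_list_prod, List.map_map]
  rfl

variable {φ} (H : IsFinitaryKleeneOmegaAlgebra S V)

include H

theorem infProd_map_eq_smul (x : FinitarySeq (RegLang A)) :
    infProd V (x.map (φ : RegLang A →* S)) =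
      φ (x.1 0) • infProd V (x.shift.map (φ : RegLang A →* S)) :=
  H.infProd_eq_smul _

theorem infProd_map_cons (X : RegLang A) (x : FinitarySeq (RegLang A)) :
    infProd V ((x.cons X).map (φ : RegLang A →* S)) =
      φ X • infProd V (x.map (φ : RegLang A →* S)) :=
  infProd_map_eq_smul H (x.cons X)

theorem infProd_map_blocks (x : FinitarySeq (RegLang A)) {b : ℕ → ℕ} (h0 : b 0 = 0)
    (hb : Monotone b) (ht : Tendsto b atTop atTop) :
    infProd V (x.map (φ : RegLang A →* S)) = infProd V ((x.blocks b).map (φ : RegLang A →* S)) := by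
  rw [map_blocks]
  exact H.infProd_blocks _ b h0 hb ht

theorem isLUB_infProd_map_kstar (hφ : ∀ X, φ X∗ = (φ X)∗) (e : RegLang A)
    (x : FinitarySeq (RegLang A)) :
    IsLUB (range fun k : ℕ → ℕ => infProd V ((x.powMul e k).map (φ : RegLang A →* S)))
      (infProd V ((x.mulLeft (e∗)).map (φ : RegLang A →* S))) := by
  convert H.isLUB_infProd_star (φ e) (x.map (φ : RegLang A →* S)) using 1
  · congr 1
    funext k
    exact infProd_congr fun n => (map_mul φ _ _).trans (by rw [map_pow]; rfl)
  · exact infProd_congr fun n => (map_mul φ _ _).trans (by rw [hφ]; rfl)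

theorem isLUB_infProd_map_add (e f : RegLang A) (x : FinitarySeq (RegLang A)) :
    IsLUB {v : V | ∃ (c : ℕ → RegLang A) (hc : ∀ n, c n ∈ ({e, f} : Set (RegLang A))),
        v = infProd V ((x.mulChoice e f c hc).map (φ : RegLang A →* S))}
      (infProd V ((x.mulRight (e + f)).map (φ : RegLang A →* S))) := by
  classical
  have h0 : infProd V ((x.mulRight (e + f)).map (φ : RegLang A →* S)) =
      infProd V ((x.map (φ : RegLang A →* S)).mulRight (φ e + φ f)) :=
    infProd_congr fun n => (map_mul φ _ _).trans (by rw [map_add]; rfl)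
  rw [h0]
  convert H.isLUB_infProd_add (x.map (φ : RegLang A →* S)) (φ e) (φ f) using 1
  ext v
  constructor
  · rintro ⟨c, hc, rfl⟩
    refine ⟨fun n => φ (c n), fun n => ?_, infProd_congr fun n => map_mul φ _ _⟩
    exact (hc n).imp (congrArg φ) (congrArg φ)
  · rintro ⟨c, hc, rfl⟩
    have hc' : ∀ n, ∃ C ∈ ({e, f} : Set (RegLang A)), φ C = c n := fun n => by
      rcases hc n with h | h
      · exact ⟨e, Or.inl rfl, h.symm⟩
      · exact ⟨f, Or.inr rfl, h.symm⟩
    -- Every choice between `φ e` and `φ f` lifts to a choice between `e` and `f`, even if the two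
    -- values coincide.
    choose C hC hCc using hc'
    refine ⟨C, hC, infProd_congr fun n => Eq.symm ((map_mul φ _ _).trans ?_)⟩
    rw [hCc]
    rfl

theorem infProd_map_mulRight_zero (x : FinitarySeq (RegLang A)) :
    infProd V ((x.mulRight 0).map (φ : RegLang A →* S)) = ⊥ := by
  rw [infProd_map_eq_smul H]
  show φ (x.1 0 * 0) • _ = _
  rw [mul_zero, map_zero, H.zero_smul]

theorem IsStreamValue.append {s : Stream' A} {b : V} (h : IsStreamValue φ s b) (w : List A) :
    IsStreamValue φ (Stream'.appendStream' w s)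
      (wordVal (fun a => φ (RegLang.letter a)) w • b) := by
  induction w with
  | nil =>
    show IsStreamValue φ s ((1 : S) • b)
    rwa [H.one_smul]
  | cons a w ih =>
    obtain ⟨hs, e⟩ := ih
    have hcons := H.infProd_cons (φ (RegLang.letter a)) ⟨_, hs⟩
    have hfun : (fun n => φ (RegLang.letter ((Stream'.appendStream' (a :: w) s).get n))) =
        (FinitarySeq.cons (φ (RegLang.letter a)) ⟨_, hs⟩).1 := by
      funext n
      cases n <;> rfl
    refine ⟨hfun ▸ Subtype.property _, ?_⟩
    show _ = (φ (RegLang.letter a) * wordVal _ w) • b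
    rw [H.mul_smul, ← e, ← hcons]
    exact infProd_congr fun n => congrFun hfun n

/-- Infinite products of single words. -/
theorem infProd_map_word (h1 : omegaPow V (1 : S) = ⊥) {F : Set A} (hF : F.Finite)
    {x : FinitarySeq (RegLang A)} (hx : ∀ n, x.1 n ∈ Submonoid.closure (RegLang.letter '' F)) :
    (∃ s, (∀ t, t ∈ (infProd (RegOmega A) x).1 ↔ t = s) ∧
      IsStreamValue φ s (infProd V (x.map (φ : RegLang A →* S)))) ∨
    ((∀ t, t ∉ (infProd (RegOmega A) x).1) ∧ infProd V (x.map (φ : RegLang A →* S)) = ⊥) := by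
  choose w hwF hw using fun n => RegLang.exists_word_of_mem_closure (hx n)
  have hmem : ∀ t, t ∈ (infProd (RegOmega A) x).1 ↔ OmegaConcat w t := by
    intro t
    rw [RegOmega.mem_infProd]
    constructor
    · rintro ⟨u, hu, hut⟩
      have : u = w := funext fun n => RegLang.mem_word.1 (hw n ▸ hu n)
      rwa [← this]
    · intro h
      exact ⟨w, fun n => hw n ▸ RegLang.mem_word.2 rfl, h⟩
  simp only [hmem]
  rcases exists_omegaConcat_or_eventually_nil w with ⟨s, hs⟩ | ⟨N, hN⟩
  · refine Or.inl ⟨s, fun t => ⟨fun ht => ht.unique hs, fun h => h ▸ hs⟩, ?_⟩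
    -- Only finitely many letters occur in `s`, so its letter values form a finitary sequence even
    -- if `A` is infinite.
    have hsF : ∀ n, s.get n ∈ F := fun n => by
      obtain ⟨k, hk⟩ := hs.exists_mem n
      exact hwF k _ hk
    refine ⟨.of_mem_finite (hF.image fun a => φ (RegLang.letter a)) fun n =>
      mem_image_of_mem _ (hsF n), ?_⟩
    refine H.infProd_eq_infProd_of_omegaConcat (hs.map fun a => φ (RegLang.letter a)) fun n => ?_
    show φ (x.1 n) = _
    rw [hw n, RegLang.map_word]
    rfl
  · refine Or.inr ⟨fun t ht => ?_, H.infProd_eq_bot_of_eventually_one h1 (N := N) fun n hn => ?_⟩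
    · obtain ⟨n, hn⟩ := ht.2 ((prefixWord w N).length + 1)
      have : ∀ n, (prefixWord w n).length ≤ (prefixWord w N).length := by
        intro n
        rcases le_total n N with h | h
        · exact (prefixWord_prefix w h).length_le
        · induction n, h using Nat.le_induction with
          | base => exact le_rfl
          | succ n hNn ih => rw [prefixWord_succ, hN n hNn, List.append_nil]; exact ih
      have := this n
      omega
    · show φ (x.1 n) = 1
      rw [hw n, RegLang.map_word, hN n hn]
      rfl

end Values

/-- The leading letter comes from the first nonempty factor word; all factor words before it are
empty. -/
theorem exists_of_cons_mem_infProd {A : Type u} {a : A} {s : Stream' A}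
    {x : FinitarySeq (RegLang A)} (h : Stream'.cons a s ∈ (infProd (RegOmega A) x).1) :
    ∃ n, (∀ m < n, [] ∈ (x.1 m).lang) ∧ ∃ t, a :: t ∈ (x.1 n).lang ∧
      ∃ r ∈ (infProd (RegOmega A) (x.drop (n + 1))).1, s = Stream'.appendStream' t r := by
  obtain ⟨u, hu, hus⟩ := h
  obtain ⟨N, hN⟩ := hus.eventually_ne_nil
  induction N generalizing x u with
  | zero =>
    obtain ⟨r, hr, hur⟩ := (omegaConcat_cons_iff u _).1 hus
    obtain ⟨b, t, hbt⟩ := List.exists_cons_of_ne_nil hN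
    rw [hbt, Stream'.cons_append_stream] at hr
    obtain ⟨rfl, rfl⟩ := Stream'.cons_injective2 hr
    exact ⟨0, by simp, t, hbt ▸ hu 0, r, ⟨_, fun n => hu (n + 1), hur⟩, rfl⟩
  | succ N ih =>
    obtain ⟨r, hr, hur⟩ := (omegaConcat_cons_iff u _).1 hus
    rcases hu0 : u 0 with _ | ⟨b, t⟩
    · rw [hu0] at hr
      obtain rfl : Stream'.cons a s = r := hr
      obtain ⟨n, hn, t, ht, r, hr, hs⟩ :=
        ih (x := x.shift) (fun n => u (n + 1)) (fun n => hu (n + 1)) hur hN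
      refine ⟨n + 1, fun m hm => ?_, t, ht, r, hr, hs⟩
      cases m with
      | zero => exact hu0 ▸ hu 0
      | succ m => exact hn m (by omega)
    · rw [hu0, Stream'.cons_append_stream] at hr
      obtain ⟨rfl, rfl⟩ := Stream'.cons_injective2 hr
      exact ⟨0, by simp, t, hu0 ▸ hu 0, r, ⟨_, fun n => hu (n + 1), hur⟩, rfl⟩

theorem RegLang.one_le_iff {A : Type u} {X : RegLang A} : 1 ≤ X ↔ [] ∈ X.lang := by
  rw [RegLang.le_iff]
  exact ⟨fun h => h _ (RegLang.mem_one.2 rfl), fun h w hw => by rwa [RegLang.mem_one.1 hw]⟩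

/-! ### Left quotients and monotonicity of values -/

section Values

variable {A : Type u} {S : Type v} {V : Type w} [IdemSemiring S] [KStar S] [SemilatticeSup V]
  [OrderBot V] [FinitaryOmegaOps S V] {φ : RegLang A →+* S}
  (H : IsFinitaryKleeneOmegaAlgebra S V)

include H

/-- A membership `s ∈ ∏ xₙ` can be traced through every step of the induction: it selects exponents,
summands or a word of the first factor, until only single words remain. -/
theorem exists_isStreamValue_le (h1 : omegaPow V (1 : S) = ⊥) (hφ : ∀ X, φ X∗ = (φ X)∗)
    (x : FinitarySeq (RegLang A)) : ∀ s ∈ (infProd (RegOmega A) x).1,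
      ∃ c, IsStreamValue φ s c ∧ c ≤ infProd V (x.map (φ : RegLang A →* S)) := by
  induction x using RegLang.finitarySeq_induction with
  | hblocks x b h0 hb ht =>
    rw [← RegOmega.infProd_blocks x h0 hb ht, ← infProd_map_blocks H x h0 hb ht]
  | hshift x ih =>
    rw [RegOmega.infProd_eq_smul, infProd_map_eq_smul H]
    rintro _ ⟨w, hw, t, ht, rfl⟩
    obtain ⟨c, hc, hle⟩ := ih t ht
    exact ⟨_, hc.append H w, H.smul_le_smul (RegLang.wordVal_le φ hw) hle⟩
  | hstar e x ih =>
    intro s hs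
    obtain ⟨k, hk⟩ := RegOmega.mem_infProd_mulLeft_kstar hs
    obtain ⟨c, hc, hle⟩ := ih k s hk
    exact ⟨c, hc, hle.trans ((isLUB_infProd_map_kstar H hφ e x).1 ⟨k, rfl⟩)⟩
  | hadd e f x ih =>
    intro s hs
    obtain ⟨d, hd, h⟩ := RegOmega.mem_infProd_mulRight_add hs
    obtain ⟨c, hc, hle⟩ := ih d hd s h
    exact ⟨c, hc, hle.trans ((isLUB_infProd_map_add H e f x).1 ⟨d, hd, rfl⟩)⟩
  | hzero x =>
    intro s hs
    -- The language algebra itself, with the identity as `φ`, shows that the product is empty.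
    have := infProd_map_mulRight_zero (φ := RingHom.id (RegLang A))
      RegOmega.isFinitaryKleeneOmegaAlgebra x
    exact (RegOmega.notMem_bot s (this ▸ hs)).elim
  | hletter F x hF hx =>
    intro s hs
    rcases infProd_map_word (φ := φ) H h1 hF hx with ⟨t, ht, hv⟩ | ⟨h, _⟩
    · exact ⟨_, (ht s).1 hs ▸ hv, le_rfl⟩
    · exact (h s hs).elim

theorem IsValue.exists_isStreamValue_le (h1 : omegaPow V (1 : S) = ⊥)
    (hφ : ∀ X, φ X∗ = (φ X)∗) {Z : RegOmega A} {b : V} (h : IsValue φ Z b) :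
    ∀ s ∈ Z.1, ∃ c, IsStreamValue φ s c ∧ c ≤ b := by
  induction h with
  | bot => exact fun s hs => (RegOmega.notMem_bot s hs).elim
  | infProd x => exact _root_.exists_isStreamValue_le H h1 hφ x
  | sup _ _ ih ih' =>
    rintro s (hs | hs)
    · obtain ⟨c, hc, hle⟩ := ih s hs
      exact ⟨c, hc, hle.trans le_sup_left⟩
    · obtain ⟨c, hc, hle⟩ := ih' s hs
      exact ⟨c, hc, hle.trans le_sup_right⟩

/-- Left quotients of infinite products by letters. -/
theorem exists_isValue_deriv_infProd (a : A) (x : FinitarySeq (RegLang A)) :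
    ∃ (Z : RegOmega A) (b : V), IsValue φ Z b ∧
      (∀ s, Stream'.cons a s ∈ (infProd (RegOmega A) x).1 → s ∈ Z.1) ∧
      φ (RegLang.letter a) • b ≤ infProd V (x.map (φ : RegLang A →* S)) := by
  classical
  obtain ⟨T, hT, hx⟩ := isFinitary_iff_closure.1 x.2
  obtain ⟨y, b, hy, h0, hb, ht, rfl⟩ := FinitarySeq.exists_eq_blocks hT hx
  rw [← RegOmega.infProd_blocks y h0 hb ht, ← infProd_map_blocks H y h0 hb ht]
  -- The quotient is the union of the `(a⁻¹ yₙ) ∏_{m>n} yₘ` over all `n` preceded only by factors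
  -- containing `ε`. This union may be infinite, so the indices are sorted by the value of `yₙ`, of
  -- which there are finitely many.
  suffices ∀ G : Set (RegLang A), G.Finite → ∃ (Z : RegOmega A) (b : V), IsValue φ Z b ∧
      (∀ n, y.1 n ∈ G → (∀ m < n, [] ∈ (y.1 m).lang) → ∀ t, a :: t ∈ (y.1 n).lang →
        ∀ r ∈ (infProd (RegOmega A) (y.drop (n + 1))).1, Stream'.appendStream' t r ∈ Z.1) ∧
      φ (RegLang.letter a) • b ≤ infProd V (y.map (φ : RegLang A →* S)) by
    obtain ⟨Z, b, hZ, hs, hle⟩ := this _ (hT.insert 1)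
    refine ⟨Z, b, hZ, fun s h => ?_, hle⟩
    obtain ⟨n, hn, t, ht, r, hr, rfl⟩ := exists_of_cons_mem_infProd h
    exact hs n (hy n) hn t ht r hr
  intro G hG
  induction G, hG using Set.Finite.induction_on with
  | empty => exact ⟨⊥, ⊥, .bot, fun n hn => hn.elim, by rw [H.smul_bot]; exact bot_le⟩
  | @insert Q G _ _ ih =>
    obtain ⟨Z, b, hZ, hs, hle⟩ := ih
    -- For each value `Q` the first such index `N` suffices: at a later one `n`, all of `y_{N+1}, …,
    -- yₙ` contain `ε`, the last because `yₙ = Q = y_N`, so the tail after `n` is included in the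
    -- tail after `N`.
    by_cases hQ : ∃ n, y.1 n = Q ∧ ∀ m < n, [] ∈ (y.1 m).lang
    · obtain ⟨hn, hm⟩ := Nat.find_spec hQ
      have hmin : ∀ n, y.1 n = Q → (∀ m < n, [] ∈ (y.1 m).lang) → Nat.find hQ ≤ n :=
        fun n h h' => Nat.find_min' hQ ⟨h, h'⟩
      generalize Nat.find hQ = N at hn hm hmin
      obtain ⟨D, hD⟩ := RegLang.exists_deriv a Q
      refine ⟨_, _, (IsValue.infProd ((y.drop (N + 1)).cons D)).sup hZ, ?_, ?_⟩
      · rintro n (hnQ | hnG) hn' t ht r hr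
        · left
          rw [RegOmega.isFinitaryKleeneOmegaAlgebra.infProd_cons]
          refine ⟨t, (hD t).2 (hnQ ▸ ht), r, ?_, rfl⟩
          have hNn := hmin n hnQ hn'
          have hle := RegOmega.isFinitaryKleeneOmegaAlgebra.infProd_drop_le
            (x := y.drop (N + 1)) (m := n - N) fun k hk => by
              rw [RegLang.one_le_iff]
              show [] ∈ (y.1 (k + (N + 1))).lang
              rcases (show k + (N + 1) < n ∨ k + (N + 1) = n by omega) with h | h
              · exact hn' _ h
              · rw [h, hnQ, ← hn]
                exact hn' N (by omega)
          refine hle ?_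
          have heq : infProd (RegOmega A) ((y.drop (N + 1)).drop (n - N)) =
              infProd (RegOmega A) (y.drop (n + 1)) :=
            infProd_congr fun k =>
              congrArg y.1 (show k + (n - N) + (N + 1) = k + (n + 1) by omega)
          rw [heq]
          exact hr
        · exact Or.inr (hs n hnG hn' t ht r hr)
      · rw [H.smul_sup]
        refine sup_le ?_ hle
        rw [infProd_map_cons H, ← H.mul_smul, ← map_mul]
        -- The factors before `N` have values above `1` and may be omitted; then `{a} D ≤ Q = y_N`
        -- gives the bound.
        refine le_trans ?_ (H.infProd_drop_le (m := N) fun n hn => ?_)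
        · rw [H.infProd_eq_smul (FinitarySeq.drop _ N)]
          refine H.smul_le_smul ?_ (le_of_eq (infProd_congr fun k => ?_))
          · show _ ≤ φ (y.1 (0 + N))
            rw [zero_add, hn]
            refine RegLang.map_mono φ (RegLang.le_iff.2 fun w hw => ?_)
            obtain ⟨u, hu, t, ht, rfl⟩ := RegLang.mem_mul.1 hw
            rw [RegLang.mem_letter.1 hu]
            exact (hD t).1 ht
          · exact congrArg (fun i => φ (y.1 i)) (by omega)
        · show 1 ≤ φ (y.1 n)
          rw [← map_one φ]
          exact RegLang.map_mono φ (RegLang.one_le_iff.2 (hm n hn))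
    · refine ⟨Z, b, hZ, ?_, hle⟩
      rintro n (hnQ | hnG) hn'
      · exact (hQ ⟨n, hnQ, hn'⟩).elim
      · exact hs n hnG hn'

theorem IsValue.exists_deriv {Z : RegOmega A} {b : V} (h : IsValue φ Z b) (a : A) :
    ∃ (Z' : RegOmega A) (b' : V), IsValue φ Z' b' ∧
      (∀ s, Stream'.cons a s ∈ Z.1 → s ∈ Z'.1) ∧ φ (RegLang.letter a) • b' ≤ b := by
  induction h with
  | bot => exact ⟨⊥, ⊥, .bot, fun s hs => hs, by rw [H.smul_bot]⟩
  | infProd x => exact exists_isValue_deriv_infProd H a x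
  | sup _ _ ih ih' =>
    obtain ⟨Z, b, hZ, hs, hle⟩ := ih
    obtain ⟨Z', b', hZ', hs', hle'⟩ := ih'
    refine ⟨_, _, hZ.sup hZ', fun s h => h.imp (hs s) (hs' s), ?_⟩
    rw [H.smul_sup]
    exact sup_le_sup hle hle'

/-- Iterates the letter quotients. Inclusion of the quotient in `Z'` is enough, since `w b' ≤ b`
controls any excess. -/
theorem IsValue.exists_word_deriv {Z : RegOmega A} {b : V} (h : IsValue φ Z b) (w : List A) :
    ∃ (Z' : RegOmega A) (b' : V), IsValue φ Z' b' ∧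
      (∀ s, Stream'.appendStream' w s ∈ Z.1 → s ∈ Z'.1) ∧
      wordVal (fun a => φ (RegLang.letter a)) w • b' ≤ b := by
  induction w generalizing Z b with
  | nil => exact ⟨Z, b, h, fun s hs => hs, (H.one_smul b).le⟩
  | cons a w ih =>
    obtain ⟨Z₁, b₁, h₁, hs₁, hle₁⟩ := h.exists_deriv H a
    obtain ⟨Z₂, b₂, h₂, hs₂, hle₂⟩ := ih h₁
    refine ⟨Z₂, b₂, h₂, fun s hs => hs₂ s (hs₁ _ hs), ?_⟩
    show (φ (RegLang.letter a) * wordVal _ w) • b₂ ≤ b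
    rw [H.mul_smul]
    exact (H.smul_le_smul le_rfl hle₂).trans hle₁

theorem isLUB_wordVal_smul (hφ : ∀ X, φ X∗ = (φ X)∗) (X : RegLang A) (v : V) :
    IsLUB {b | ∃ w ∈ X.lang, wordVal (fun a => φ (RegLang.letter a)) w • v = b} (φ X • v) := by
  obtain ⟨r, rfl⟩ := X.exists_ofRegex
  rw [RegLang.map_ofRegex hφ]
  have := isActLUB_regEval (M := V) (act := fun (s : S) v => s • v) H.zero_smul H.add_smul
    H.mul_smul H.isLUB_mul_pow_smul (fun a => φ (RegLang.letter a)) r 1 v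
  simp only [one_mul] at this
  exact this

/-- The target `Z` is quantified inside the induction because it is replaced by a quotient whenever
a factor is put in front. -/
theorem infProd_map_le_of_isValue (h1 : omegaPow V (1 : S) = ⊥) (hφ : ∀ X, φ X∗ = (φ X)∗)
    (x : FinitarySeq (RegLang A)) : ∀ (Z : RegOmega A) (b : V), IsValue φ Z b →
      infProd (RegOmega A) x ≤ Z → infProd V (x.map (φ : RegLang A →* S)) ≤ b := by
  have H0 := RegOmega.isFinitaryKleeneOmegaAlgebra (A := A)
  induction x using RegLang.finitarySeq_induction with
  | hblocks x b h0 hb ht =>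
    rw [← RegOmega.infProd_blocks x h0 hb ht, ← infProd_map_blocks H x h0 hb ht]
  | hshift x ih =>
    intro Z b hZ hle
    rw [infProd_map_eq_smul H]
    -- Only the first factor is expanded into words, a supremum granted by `*`-continuity of the
    -- action; the tail stays intact.
    refine (isLUB_wordVal_smul H hφ _ _).2 ?_
    rintro _ ⟨w, hw, rfl⟩
    obtain ⟨Z', b', hZ', hs, hle'⟩ := hZ.exists_word_deriv H w
    refine (H.smul_le_smul le_rfl (ih Z' b' hZ' fun s h => hs s (hle ?_))).trans hle'
    rw [RegOmega.infProd_eq_smul]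
    exact ⟨w, hw, s, h, rfl⟩
  | hstar e x ih =>
    intro Z b hZ hle
    refine (isLUB_infProd_map_kstar H hφ e x).2 ?_
    rintro _ ⟨k, rfl⟩
    exact ih k Z b hZ (((H0.isLUB_infProd_star e x).1 ⟨k, rfl⟩).trans hle)
  | hadd e f x ih =>
    intro Z b hZ hle
    refine (isLUB_infProd_map_add H e f x).2 ?_
    rintro _ ⟨c, hc, rfl⟩
    exact ih c hc Z b hZ (((H0.isLUB_infProd_add x e f).1 ⟨c, hc, rfl⟩).trans hle)
  | hzero x =>
    intro Z b _ _
    rw [infProd_map_mulRight_zero H]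
    exact bot_le
  | hletter F x hF hx =>
    intro Z b hZ hle
    rcases infProd_map_word (φ := φ) H h1 hF hx with ⟨s, hs, _, hv⟩ | ⟨_, h⟩
    · obtain ⟨c, ⟨_, hc⟩, hcb⟩ := hZ.exists_isStreamValue_le H h1 hφ s (hle ((hs s).2 rfl))
      rw [← hv]
      exact hc.le.trans hcb
    · rw [h]
      exact bot_le

theorem IsValue.mono (h1 : omegaPow V (1 : S) = ⊥) (hφ : ∀ X, φ X∗ = (φ X)∗)
    {Z W : RegOmega A} {b c : V} (hZ : IsValue φ Z b) (hW : IsValue φ W c) (h : Z ≤ W) :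
    b ≤ c := by
  induction hZ with
  | bot => exact bot_le
  | infProd x => exact infProd_map_le_of_isValue H h1 hφ x W c hW h
  | sup _ _ ih ih' => exact sup_le (ih (le_sup_left.trans h)) (ih' (le_sup_right.trans h))

theorem IsValue.unique (h1 : omegaPow V (1 : S) = ⊥) (hφ : ∀ X, φ X∗ = (φ X)∗)
    {Z : RegOmega A} {b c : V} (hb : IsValue φ Z b) (hc : IsValue φ Z c) : b = c :=
  le_antisymm (hb.mono H h1 hφ hc le_rfl) (hc.mono H h1 hφ hb le_rfl)

theorem IsValue.smul {Z : RegOmega A} {b : V} (h : IsValue φ Z b) (X : RegLang A) :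
    IsValue φ (X • Z) (φ X • b) := by
  have H0 := RegOmega.isFinitaryKleeneOmegaAlgebra (A := A)
  induction h with
  | bot =>
    rw [H0.smul_bot, H.smul_bot]
    exact .bot
  | infProd x =>
    rw [← H0.infProd_cons, ← infProd_map_cons H]
    exact .infProd _
  | sup _ _ ih ih' =>
    rw [H0.smul_sup, H.smul_sup]
    exact ih.sup ih'

theorem exists_kleeneOmegaHom (h1 : omegaPow V (1 : S) = ⊥) (hφ : ∀ X, φ X∗ = (φ X)∗) :
    ∃ ψ : KleeneOmegaHom (RegLang A) (RegOmega A) S V, ψ.onS = φ := by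
  choose f hf using exists_isValue (V := V) φ
  exact ⟨{
    onS := φ
    onV :=
      { toFun := f
        map_sup' := fun Z W => (hf _).unique H h1 hφ ((hf Z).sup (hf W))
        map_bot' := (hf _).unique H h1 hφ .bot }
    map_kstar := hφ
    map_smul := fun X Z => (hf _).unique H h1 hφ ((hf Z).smul H X)
    map_infProd := fun x => (hf _).unique H h1 hφ (.infProd x) }, rfl⟩

end Values

/-! ### Uniqueness and the freeness theorem -/

theorem KleeneOmegaHom.ext_of_letter {A : Type u} {S : Type v} {V : Type w} [IdemSemiring S]
    [KStar S] [SemilatticeSup V] [OrderBot V] [FinitaryOmegaOps S V]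
    {φ ψ : KleeneOmegaHom (RegLang A) (RegOmega A) S V}
    (h : ∀ a, φ.onS (RegLang.letter a) = ψ.onS (RegLang.letter a)) : φ = ψ := by
  have hS : φ.onS = ψ.onS := by
    refine RingHom.ext fun X => ?_
    obtain ⟨r, rfl⟩ := X.exists_ofRegex
    rw [RegLang.map_ofRegex φ.map_kstar, RegLang.map_ofRegex ψ.map_kstar, funext h]
  have hV : φ.onV = ψ.onV := by
    refine DFunLike.ext _ _ fun Z => ?_
    induction Z using RegOmega.induction with
    | hbot => exact φ.onV.map_bot'.trans ψ.onV.map_bot'.symm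
    | hprod x => rw [φ.map_infProd, ψ.map_infProd, hS]
    | hsup Z W hZ hW => rw [SupHomClass.map_sup, SupHomClass.map_sup, hZ, hW]
  obtain ⟨_, _, _, _, _⟩ := φ
  obtain ⟨_, _, _, _, _⟩ := ψ
  congr

theorem mainTheorem5 (A : Type u) :
    IsFinitaryKleeneOmegaAlgebra (RegLang A) (RegOmega A) ∧
    omegaPow (RegOmega A) (1 : RegLang A) = ⊥ ∧
    ∀ (S : Type v) (V : Type w) [IdemSemiring S] [KStar S] [SemilatticeSup V] [OrderBot V]
      [FinitaryOmegaOps S V],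
      IsFinitaryKleeneOmegaAlgebra S V → omegaPow V (1 : S) = ⊥ →
      ∀ h : A → S, ∃! φ : KleeneOmegaHom (RegLang A) (RegOmega A) S V,
        ∀ a : A, φ.onS (RegLang.letter a) = h a := by
  refine ⟨RegOmega.isFinitaryKleeneOmegaAlgebra, RegOmega.omegaPow_one, ?_⟩
  intro S V _ _ _ _ _ H h1 h
  have := H.toIsStarContinuous
  obtain ⟨φ, hφ⟩ := exists_kleeneOmegaHom H h1 (φ := RegLang.lift h) (RegLang.lift_kstar h)
  refine ⟨φ, fun a => by rw [hφ, RegLang.lift_letter], fun ψ hψ => ?_⟩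
  exact KleeneOmegaHom.ext_of_letter fun a => by rw [hψ, hφ, RegLang.lift_letter]
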